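/- Let $X$ and $Y$ be strings of lengths $m$ and $n$ over a linearly ordered alphabet $\Sigma$ and let $k\ge 1$ be an integer. Two strings $S,T$ of the same length $l$ are order-isomorphic, $S\approx T$, if $S[a]\le S[b]\Leftrightarrow T[a]\le T[b]$ for all $1\le a,b\le l$. Write $W[i{:}{+}l]$ for the substring of $W$ of length $l$ beginning at position $i$. A string $Z$ over $\Sigma$ is a common subsequence in at least $k$ length order-isomorphic substrings of $X$ and $Y$ if there are $t\ge 0$ and $i_1,\dots,i_t$, $j_1,\dots,j_t$, $l_1,\dots,l_t\ge k$, $p_1,\dots,p_t$ such that $X[i_s{:}{+}l_s]\approx Y[j_s{:}{+}l_s]\approx Z[p_s{:}{+}l_s]$ for $1\le s\le t$, such that $i_s+l_s\le i_{s+1}$, $j_s+l_s\le j_{s+1}$ and $p_{s+1}=p_s+l_s$ for $1\le s<t$, and such that $p_1=1$ and $|Z|=p_t+l_t-1$ (for $t=0$, $Z$ is empty). The op-LCS$_{k^+}$ problem asks, given $X$, $Y$ and $k$, for the maximum length of such a $Z$. Theorem. The op-LCS$_{k^+}$ problem can be solved in $O(mn)$ time and $O(mn)$ space. That is, there are a single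 program for a random access machine with unit-cost operations (addition, truncated subtraction and multiplication of words, comparison of words, indirect loads and stores, and comparison of two input characters in the order of $\Sigma$, the only access to the characters) and a constant $c$ such that for every linearly ordered alphabet $\Sigma$, all strings $X,Y$ over $\Sigma$ of lengths $m,n$ and every $k\ge 1$, the program started with $m$, $n$, $k$ in its registers and with $X\cdot Y$ as read-only input halts with the answer after at most $c(mn+1)$ steps, uses only memory cells with addresses less than $c(mn+1)$, and computes only words less than $(m+n+k+2)^c$, that is, of $O(\log(m+n+k))$ bits. -/

import Mathlib

universe u

namespace OpLCS

/-! Strings are lists over a linearly ordered alphabet; positions are counted from `0`. -/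

/-- The substring of `X` of length `l` that begins at position `i`
(it has length `l` exactly when `i + l ≤ X.length`, for `l > 0`). -/
def substr {α : Type u} (X : List α) (i l : ℕ) : List α := (X.drop i).take l

/-- Order-isomorphism of two strings of the same length. -/
def OrderIsomorphic {α : Type u} [LE α] (S T : List α) : Prop :=
  ∃ h : S.length = T.length, ∀ (a b : ℕ) (ha : a < S.length) (hb : b < S.length),
    S[a] ≤ S[b] ↔ T[a]'(h ▸ ha) ≤ T[b]'(h ▸ hb)

/-- `Z` is a common subsequence of `X` and `Y` in at least `k` length order-isomorphic substrings:
the `s`-th chunk (`s < t`) has length `l s ≥ k` and begins at position `i s` of `X`, `j s` of `Y`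
and `p s` of `Z`; the chunks are disjoint and in order in `X` and in `Y`, and they tile `Z`. -/
def IsCommonSubseq {α : Type u} [LE α] (k : ℕ) (X Y Z : List α) : Prop :=
  ∃ (t : ℕ) (i j l p : ℕ → ℕ),
    (∀ s < t, k ≤ l s ∧ i s + l s ≤ X.length ∧ j s + l s ≤ Y.length ∧
      OrderIsomorphic (substr X (i s) (l s)) (substr Y (j s) (l s)) ∧
      OrderIsomorphic (substr Y (j s) (l s)) (substr Z (p s) (l s))) ∧
    (∀ s, s + 1 < t → i s + l s ≤ i (s + 1) ∧ j s + l s ≤ j (s + 1)) ∧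
    p 0 = 0 ∧ (∀ s < t, p (s + 1) = p s + l s) ∧ Z.length = p t

/-- `v` is the length of a longest common subsequence of `X` and `Y`
in at least `k` length order-isomorphic substrings. -/
def IsOpLCSLength {α : Type u} [LE α] (k : ℕ) (X Y : List α) (v : ℕ) : Prop :=
  IsGreatest {z : ℕ | ∃ Z : List α, IsCommonSubseq k X Y Z ∧ Z.length = z} v

/-! The machine: a random access machine with unit-cost operations on words, whose programs are
built from elementary instructions by composition, branching and loops. A program names finitely
many registers. The input characters sit in a read-only array, and the only thing the machine can
do with them is to compare two of them with respect to the order of the alphabet. -/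

/-- The right-hand sides of assignments; the arguments of the operations are register names. -/
inductive Expr : Type
  | const (v : ℕ)
  | reg (a : ℕ)
  | add (a b : ℕ)
  | sub (a b : ℕ)
  | mul (a b : ℕ)

/-- Tests: comparisons of two registers, and the comparison of the two input characters
whose positions are held in two registers. -/
inductive Test : Type
  | eq (a b : ℕ)
  | lt (a b : ℕ)
  | charLe (a b : ℕ)

/-- Programs. `load d a` puts the memory cell addressed by register `a` into register `d`;
`store a b` puts register `b` into the memory cell addressed by register `a`. -/
inductive Program : Type
  | skip
  | assign (d : ℕ) (e : Expr)
  | load (d a : ℕ)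
  | store (a b : ℕ)
  | seq (p q : Program)
  | ite (b : Test) (p q : Program)
  | while (b : Test) (p : Program)

/-- Contents of the registers and of the memory cells. -/
structure State : Type where
  reg : ℕ → ℕ
  mem : ℕ → ℕ

/-- Write `v` into register `d`. -/
def State.setReg (σ : State) (d v : ℕ) : State := { σ with reg := Function.update σ.reg d v }

/-- Write `v` into memory cell `a`. -/
def State.setMem (σ : State) (a v : ℕ) : State := { σ with mem := Function.update σ.mem a v }

/-- Value of a right-hand side; subtraction is truncated at `0`. -/
def Expr.value (σ : State) : Expr → ℕ
  | .const v => v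
  | .reg a => σ.reg a
  | .add a b => σ.reg a + σ.reg b
  | .sub a b => σ.reg a - σ.reg b
  | .mul a b => σ.reg a * σ.reg b

/-- A test may only be executed if the character positions that it names exist. -/
def Test.Legal {α : Type u} (inp : List α) (σ : State) : Test → Prop
  | .eq _ _ => True
  | .lt _ _ => True
  | .charLe a b => σ.reg a < inp.length ∧ σ.reg b < inp.length

/-- Outcome of a (legal) test. -/
def Test.Holds {α : Type u} [LE α] (inp : List α) (σ : State) : Test → Prop
  | .eq a b => σ.reg a = σ.reg b
  | .lt a b => σ.reg a < σ.reg b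
  | .charLe a b => ∃ x ∈ inp[σ.reg a]?, ∃ y ∈ inp[σ.reg b]?, x ≤ y

/-- `Exec inp S W p σ t τ`: on the input characters `inp`, the program `p`, started in state `σ` on
a machine with the `S` memory cells `0, …, S - 1` and with the words `0, …, W - 1`, halts after `t`
steps in state `τ`. Every elementary instruction and every evaluation of a test is one step.
A run that computes a number `≥ W`, addresses a memory cell `≥ S` or compares a nonexistent
character is stuck and does not halt. -/
inductive Exec {α : Type u} [LE α] (inp : List α) (S W : ℕ) :
    Program → State → ℕ → State → Prop
  | skip (σ : State) : Exec inp S W .skip σ 1 σ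
  | assign (σ : State) (d : ℕ) (e : Expr) (h : e.value σ < W) :
      Exec inp S W (.assign d e) σ 1 (σ.setReg d (e.value σ))
  | load (σ : State) (d a : ℕ) (h : σ.reg a < S) :
      Exec inp S W (.load d a) σ 1 (σ.setReg d (σ.mem (σ.reg a)))
  | store (σ : State) (a b : ℕ) (h : σ.reg a < S) :
      Exec inp S W (.store a b) σ 1 (σ.setMem (σ.reg a) (σ.reg b))
  | seq (p q : Program) (σ₁ σ₂ σ₃ : State) (t₁ t₂ : ℕ)
      (h₁ : Exec inp S W p σ₁ t₁ σ₂) (h₂ : Exec inp S W q σ₂ t₂ σ₃) :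
      Exec inp S W (.seq p q) σ₁ (t₁ + t₂) σ₃
  | iteTrue (b : Test) (p q : Program) (σ τ : State) (t : ℕ)
      (hl : b.Legal inp σ) (hb : b.Holds inp σ) (h : Exec inp S W p σ t τ) :
      Exec inp S W (.ite b p q) σ (1 + t) τ
  | iteFalse (b : Test) (p q : Program) (σ τ : State) (t : ℕ)
      (hl : b.Legal inp σ) (hb : ¬ b.Holds inp σ) (h : Exec inp S W q σ t τ) :
      Exec inp S W (.ite b p q) σ (1 + t) τ
  | whileFalse (b : Test) (p : Program) (σ : State)
      (hl : b.Legal inp σ) (hb : ¬ b.Holds inp σ) :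
      Exec inp S W (.while b p) σ 1 σ
  | whileTrue (b : Test) (p : Program) (σ₁ σ₂ σ₃ : State) (t₁ t₂ : ℕ)
      (hl : b.Legal inp σ₁) (hb : b.Holds inp σ₁)
      (h₁ : Exec inp S W p σ₁ t₁ σ₂) (h₂ : Exec inp S W (.while b p) σ₂ t₂ σ₃) :
      Exec inp S W (.while b p) σ₁ (1 + t₁ + t₂) σ₃

/-- The machine is deterministic: final state and number of steps are determined by the start. -/
theorem Exec.deterministic {α : Type u} [LE α] {inp : List α} {S W : ℕ} {p : Program}
    {σ τ τ' : State} {t t' : ℕ} (h : Exec inp S W p σ t τ) (h' : Exec inp S W p σ t' τ') :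
    t = t' ∧ τ = τ' := by
  induction h generalizing t' τ' with
  | skip | assign | load | store => cases h'; exact ⟨rfl, rfl⟩
  | seq p q σ₁ σ₂ σ₃ t₁ t₂ _ _ ih₁ ih₂ =>
    cases h' with
    | seq _ _ _ _ _ _ _ g₁ g₂ =>
      obtain ⟨rfl, rfl⟩ := ih₁ g₁
      obtain ⟨rfl, rfl⟩ := ih₂ g₂
      exact ⟨rfl, rfl⟩
  | iteTrue b p q σ τ t hl hb _ ih =>
    cases h' with
    | iteTrue _ _ _ _ _ _ _ _ g => obtain ⟨rfl, rfl⟩ := ih g; exact ⟨rfl, rfl⟩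
    | iteFalse _ _ _ _ _ _ _ hb' _ => exact absurd hb hb'
  | iteFalse b p q σ τ t hl hb _ ih =>
    cases h' with
    | iteTrue _ _ _ _ _ _ _ hb' _ => exact absurd hb' hb
    | iteFalse _ _ _ _ _ _ _ _ g => obtain ⟨rfl, rfl⟩ := ih g; exact ⟨rfl, rfl⟩
  | whileFalse b p σ hl hb =>
    cases h' with
    | whileFalse => exact ⟨rfl, rfl⟩
    | whileTrue _ _ _ _ _ _ _ _ hb' _ _ => exact absurd hb' hb
  | whileTrue b p σ₁ σ₂ σ₃ t₁ t₂ hl hb _ _ ih₁ ih₂ =>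
    cases h' with
    | whileFalse _ _ _ _ hb' => exact absurd hb hb'
    | whileTrue _ _ _ _ _ _ _ _ _ g₁ g₂ =>
      obtain ⟨rfl, rfl⟩ := ih₁ g₁
      obtain ⟨rfl, rfl⟩ := ih₂ g₂
      exact ⟨rfl, rfl⟩

/-- Start state: registers `0`, `1`, `2` hold the two string lengths `m`, `n` and the parameter
`k`; everything else is `0`. -/
def State.start (m n k : ℕ) : State where
  reg r := if r = 0 then m else if r = 1 then n else if r = 2 then k else 0
  mem _ := 0

end OpLCS

/-! Call two order-isomorphic blocks of equal length, one in each string, a match. The chunks of `Z`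
impose no restriction of their own, since the blocks of `X` can be concatenated. The answer is
therefore the largest total length of a chain of disjoint, ordered matches of length at least `k`
(`isOpLCSLength_optLen`). A best chain between two prefixes either leaves out a last character or
ends with a match of some length `q` at both ends. A suffix of a match is a match, so the possible
`q` are exactly those from `k` to the length `L` of the longest match ending there; this gives the
recurrence `optLen_succ`. Finding `L` and maximising over `q` both take amortized constant time per
cell.

Longest matches: along a diagonal `L` grows by at most one per step. A match extends by one pair of
characters iff the new pair compares correctly with just two old positions, the predecessor and the
successor of the new character of `x` in the window (`match_succ_iff`). These positions depend on
`x` alone. A table of them has `O(m²)` entries, which is `O(mn)` once `x` is the shorter string.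
Candidate lengths are tried downwards from the previous `L` plus one.

Window maxima: normalised by a constant of the diagonal, the value of a candidate stays fixed while
the cell moves (`lastValue_succ`). What is needed is the maximum over a window of the diagonal whose
two ends only move forward. A queue made of two stacks supplies it: one running maximum for the
newer (back) part, partial maxima stored in the cells for the older (front) part. When the front
part is exhausted, the whole window is turned into a new front part.

Both costs at a cell are, up to constants, `f i j + 1 - f (i + 1) (j + 1)` with `f` zero on the
border and growing by at most one per diagonal step (`matchLen`, `backLen`). Such slacks sum to at
most `m * n` (`sum_slack_le`). -/

namespace OpLCS

/-! ### A weakest-precondition calculus with running times -/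

section Calculus

variable {α : Type u} [LE α] {inp : List α} {S W : ℕ}

@[simp] theorem State.setReg_reg (σ : State) (d v r : ℕ) :
    (σ.setReg d v).reg r = if r = d then v else σ.reg r := by
  simp [State.setReg, Function.update_apply]

@[simp] theorem State.setReg_mem (σ : State) (d v : ℕ) : (σ.setReg d v).mem = σ.mem := rfl

@[simp] theorem State.setMem_reg (σ : State) (a v : ℕ) : (σ.setMem a v).reg = σ.reg := rfl

@[simp] theorem State.setMem_mem (σ : State) (a v x : ℕ) :
    (σ.setMem a v).mem x = if x = a then v else σ.mem x := by
  simp [State.setMem, Function.update_apply]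

/-- The program halts, and running time and final state satisfy `Q`. -/
def Wp (inp : List α) (S W : ℕ) (p : Program) (σ : State) (Q : ℕ → State → Prop) : Prop :=
  ∃ t τ, Exec inp S W p σ t τ ∧ Q t τ

theorem Wp.mono {p : Program} {σ : State} {Q Q' : ℕ → State → Prop}
    (h : Wp inp S W p σ Q) (hQ : ∀ t τ, Q t τ → Q' t τ) : Wp inp S W p σ Q' := by
  obtain ⟨t, τ, h, hq⟩ := h
  exact ⟨t, τ, h, hQ _ _ hq⟩

theorem Wp.skip_iff {σ : State} {Q : ℕ → State → Prop} :
    Wp inp S W .skip σ Q ↔ Q 1 σ :=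
  ⟨fun ⟨_, _, h, hq⟩ => by cases h; exact hq, fun h => ⟨_, _, .skip σ, h⟩⟩

theorem Wp.assign_iff {σ : State} {d : ℕ} {e : Expr} {Q : ℕ → State → Prop} :
    Wp inp S W (.assign d e) σ Q ↔ e.value σ < W ∧ Q 1 (σ.setReg d (e.value σ)) :=
  ⟨fun ⟨_, _, h, hq⟩ => by cases h; exact ⟨‹_›, hq⟩, fun h => ⟨_, _, .assign σ d e h.1, h.2⟩⟩

theorem Wp.load_iff {σ : State} {d a : ℕ} {Q : ℕ → State → Prop} :
    Wp inp S W (.load d a) σ Q ↔ σ.reg a < S ∧ Q 1 (σ.setReg d (σ.mem (σ.reg a))) :=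
  ⟨fun ⟨_, _, h, hq⟩ => by cases h; exact ⟨‹_›, hq⟩, fun h => ⟨_, _, .load σ d a h.1, h.2⟩⟩

theorem Wp.store_iff {σ : State} {a b : ℕ} {Q : ℕ → State → Prop} :
    Wp inp S W (.store a b) σ Q ↔ σ.reg a < S ∧ Q 1 (σ.setMem (σ.reg a) (σ.reg b)) :=
  ⟨fun ⟨_, _, h, hq⟩ => by cases h; exact ⟨‹_›, hq⟩, fun h => ⟨_, _, .store σ a b h.1, h.2⟩⟩

theorem Wp.seq_iff {σ : State} {p q : Program} {Q : ℕ → State → Prop} :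
    Wp inp S W (.seq p q) σ Q ↔
      Wp inp S W p σ fun t τ => Wp inp S W q τ fun t' τ' => Q (t + t') τ' := by
  constructor
  · rintro ⟨_, _, h, hq⟩
    cases h with
    | seq _ _ _ σ₂ _ t₁ t₂ h₁ h₂ => exact ⟨_, _, h₁, _, _, h₂, hq⟩
  · rintro ⟨_, _, h₁, _, _, h₂, hq⟩
    exact ⟨_, _, .seq _ _ _ _ _ _ _ h₁ h₂, hq⟩

theorem Wp.ite_iff {σ : State} {b : Test} {p q : Program} {Q : ℕ → State → Prop} :
    Wp inp S W (.ite b p q) σ Q ↔ b.Legal inp σ ∧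
      (b.Holds inp σ → Wp inp S W p σ fun t τ => Q (1 + t) τ) ∧
      (¬ b.Holds inp σ → Wp inp S W q σ fun t τ => Q (1 + t) τ) := by
  constructor
  · rintro ⟨_, _, h, hq⟩
    cases h with
    | iteTrue _ _ _ _ _ _ hl hb h => exact ⟨hl, fun _ => ⟨_, _, h, hq⟩, fun h' => absurd hb h'⟩
    | iteFalse _ _ _ _ _ _ hl hb h => exact ⟨hl, fun h' => absurd h' hb, fun _ => ⟨_, _, h, hq⟩⟩
  · rintro ⟨hl, h₁, h₂⟩
    by_cases hb : b.Holds inp σ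
    · obtain ⟨t, τ, h, hq⟩ := h₁ hb
      exact ⟨_, _, .iteTrue _ _ _ _ _ _ hl hb h, hq⟩
    · obtain ⟨t, τ, h, hq⟩ := h₂ hb
      exact ⟨_, _, .iteFalse _ _ _ _ _ _ hl hb h, hq⟩

/-- A loop whose potential `Φ` pays for every iteration halts within the initial potential. -/
theorem Wp.while_potential {b : Test} {p : Program} (I : State → Prop) (Φ : State → ℕ)
    (hl : ∀ σ, I σ → b.Legal inp σ)
    (hp : ∀ σ, I σ → b.Holds inp σ →
      Wp inp S W p σ fun t τ => I τ ∧ Φ τ + t + 1 ≤ Φ σ)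
    {σ : State} (hσ : I σ) :
    Wp inp S W (.while b p) σ fun t τ => I τ ∧ ¬ b.Holds inp τ ∧ t ≤ Φ σ + 1 := by
  induction hn : Φ σ using Nat.strong_induction_on generalizing σ with
  | _ n ih =>
    subst hn
    by_cases hb : b.Holds inp σ
    · obtain ⟨t, τ, h, hI, ht⟩ := hp σ hσ hb
      obtain ⟨t', τ', h', hI', hb', ht'⟩ := ih (Φ τ) (by omega) hI rfl
      exact ⟨_, _, .whileTrue _ _ _ _ _ _ _ (hl σ hσ) hb h h', hI', hb', by omega⟩
    · exact ⟨_, _, .whileFalse _ _ _ (hl σ hσ) hb, hσ, hb, by omega⟩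

/-- A counting loop takes at most the sum of the costs of its rounds. -/
theorem Wp.while_lt {p : Program} {r s N : ℕ} (I : ℕ → State → Prop) (cost : ℕ → ℕ)
    (hr : ∀ i σ, I i σ → σ.reg r = i ∧ σ.reg s = N)
    (hp : ∀ i σ, i < N → I i σ → Wp inp S W p σ fun t τ => I (i + 1) τ ∧ t + 1 ≤ cost i)
    {i : ℕ} {σ : State} (hi : i ≤ N) (hσ : I i σ) :
    Wp inp S W (.while (.lt r s) p) σ fun t τ => I N τ ∧ t ≤ ∑ x ∈ Finset.Ico i N, cost x + 1 := by
  induction hn : N - i generalizing i σ with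
  | zero =>
    obtain rfl : i = N := by omega
    refine ⟨_, _, .whileFalse _ _ _ trivial ?_, hσ, by simp⟩
    simp [Test.Holds, (hr _ _ hσ).1, (hr _ _ hσ).2]
  | succ n ih =>
    obtain ⟨t, τ, h, hI, ht⟩ := hp i σ (by omega) hσ
    obtain ⟨t', τ', h', hI', ht'⟩ := ih (by omega) hI (by omega)
    refine ⟨_, _, .whileTrue _ _ _ _ _ _ _ trivial ?_ h h', hI', ?_⟩
    · simp only [Test.Holds, (hr _ _ hσ).1, (hr _ _ hσ).2]
      omega
    · rw [Finset.sum_eq_sum_Ico_succ_bot (by omega)]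
      omega

theorem Test.eq_holds_iff {σ : State} {a b : ℕ} :
    (Test.eq a b).Holds inp σ ↔ σ.reg a = σ.reg b := Iff.rfl

theorem Test.lt_holds_iff {σ : State} {a b : ℕ} :
    (Test.lt a b).Holds inp σ ↔ σ.reg a < σ.reg b := Iff.rfl

theorem charLe_holds_iff {σ : State} {a b : ℕ} {x y : α}
    (ha : inp[σ.reg a]? = some x) (hb : inp[σ.reg b]? = some y) :
    (Test.charLe a b).Holds inp σ ↔ x ≤ y := by
  simp [Test.Holds, ha, hb]

end Calculus

theorem Test.eq_legal_iff {α : Type u} {inp : List α} {σ : State} {a b : ℕ} : (Test.eq a b).Legal inp σ ↔ True := Iff.rfl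

theorem Test.lt_legal_iff {α : Type u} {inp : List α} {σ : State} {a b : ℕ} : (Test.lt a b).Legal inp σ ↔ True := Iff.rfl

theorem charLe_legal {α : Type u} {inp : List α} {σ : State} {a b : ℕ} {x y : α}
    (ha : inp[σ.reg a]? = some x) (hb : inp[σ.reg b]? = some y) :
    (Test.charLe a b).Legal inp σ :=
  ⟨(List.getElem?_eq_some_iff.1 ha).1, (List.getElem?_eq_some_iff.1 hb).1⟩

/-! ### Matching substrings and chains of them -/

section Combinatorics

variable {α : Type u} [LinearOrder α] (x y : ℕ → α)

/-- The substrings of length `l` of `x` at `a` and of `y` at `b` are order-isomorphic. -/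
def Match (a b l : ℕ) : Prop :=
  ∀ p < l, ∀ q < l, (x (a + p) ≤ x (a + q) ↔ y (b + p) ≤ y (b + q))

variable {x y}

theorem Match.symm {a b l : ℕ} (h : Match x y a b l) : Match y x b a l :=
  fun p hp q hq => (h p hp q hq).symm

theorem Match.sub {a b l : ℕ} (h : Match x y a b l) {c l' : ℕ} (hc : c + l' ≤ l) :
    Match x y (a + c) (b + c) l' := fun p hp q hq => by
  simpa only [add_assoc] using h (c + p) (by omega) (c + q) (by omega)

theorem match_one (a b : ℕ) : Match x y a b 1 := fun p hp q hq => by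
  obtain rfl : p = 0 := by omega
  obtain rfl : q = 0 := by omega
  simp

variable (x y)

/-- `Chain x y k i j v`: there are disjoint matches of lengths at least `k`, in order and of total
length `v`, between the prefixes of `x` and `y` of lengths `i` and `j`. -/
inductive Chain (k : ℕ) : ℕ → ℕ → ℕ → Prop
  | nil (i j : ℕ) : Chain k i j 0
  | snoc {a b v l i j : ℕ} (h : Chain k a b v) (hk : k ≤ l) (hi : a + l ≤ i) (hj : b + l ≤ j)
      (hm : Match x y a b l) : Chain k i j (v + l)

variable {x y} {k : ℕ}

theorem Chain.symm {i j v : ℕ} (h : Chain x y k i j v) : Chain y x k j i v := by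
  induction h with
  | nil i j => exact .nil j i
  | snoc h hk hi hj hm ih => exact .snoc ih hk hj hi hm.symm

theorem Chain.mono {i j v i' j' : ℕ} (h : Chain x y k i j v) (hi : i ≤ i') (hj : j ≤ j') :
    Chain x y k i' j' v := by
  cases h with
  | nil => exact .nil _ _
  | snoc h hk hi' hj' hm => exact .snoc h hk (hi'.trans hi) (hj'.trans hj) hm

theorem Chain.le {i j v : ℕ} (h : Chain x y k i j v) : v ≤ i ∧ v ≤ j := by
  induction h with
  | nil => simp
  | snoc h hk hi hj hm ih => omega

variable (x y k)

open Classical in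
/-- The largest total length of a chain between the prefixes of lengths `i` and `j`. -/
noncomputable def optLen (i j : ℕ) : ℕ := Nat.findGreatest (Chain x y k i j) i

open Classical in
/-- The length of the longest match that ends at the ends of the prefixes of lengths `i`, `j`. -/
noncomputable def matchLen (i j : ℕ) : ℕ :=
  Nat.findGreatest (fun l => l ≤ j ∧ Match x y (i - l) (j - l) l) i

variable {x y k}

theorem chain_optLen (i j : ℕ) : Chain x y k i j (optLen x y k i j) := by
  classical exact Nat.findGreatest_spec (P := Chain x y k i j) (Nat.zero_le i) (.nil i j)

theorem Chain.le_optLen {i j v : ℕ} (h : Chain x y k i j v) : v ≤ optLen x y k i j := by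
  classical exact Nat.le_findGreatest h.le.1 h

theorem optLen_le (i j : ℕ) : optLen x y k i j ≤ i ∧ optLen x y k i j ≤ j :=
  (chain_optLen i j).le

theorem matchLen_spec (i j : ℕ) : matchLen x y i j ≤ i ∧ matchLen x y i j ≤ j ∧
    Match x y (i - matchLen x y i j) (j - matchLen x y i j) (matchLen x y i j) := by
  classical
  have h := Nat.findGreatest_spec (P := fun l => l ≤ j ∧ Match x y (i - l) (j - l) l)
    (Nat.zero_le i) ⟨Nat.zero_le j, fun p hp => absurd hp (Nat.not_lt_zero p)⟩
  exact ⟨Nat.findGreatest_le i, h.1, h.2⟩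

/-- A suffix of a match is a match, so the lengths of the matches ending at a given pair form an
initial segment, and the longest one determines them all. -/
theorem le_matchLen_iff {i j l : ℕ} (hi : l ≤ i) (hj : l ≤ j) :
    l ≤ matchLen x y i j ↔ Match x y (i - l) (j - l) l := by
  classical
  obtain ⟨h₁, h₂, h₃⟩ := matchLen_spec (x := x) (y := y) i j
  constructor
  · intro h
    have := h₃.sub (c := matchLen x y i j - l) (l' := l) (by omega)
    rwa [show i - matchLen x y i j + (matchLen x y i j - l) = i - l by omega,
      show j - matchLen x y i j + (matchLen x y i j - l) = j - l by omega] at this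
  · exact fun h => Nat.le_findGreatest hi ⟨hj, h⟩

/-- Dropping the last pair of characters leaves a match that ends one step earlier on the diagonal.
Both amortizations and the sliding of the window rest on this. -/
theorem matchLen_succ_le (i j : ℕ) : matchLen x y (i + 1) (j + 1) ≤ matchLen x y i j + 1 := by
  obtain ⟨h₁, h₂, h₃⟩ := matchLen_spec (x := x) (y := y) (i + 1) (j + 1)
  have : matchLen x y (i + 1) (j + 1) - 1 ≤ matchLen x y i j := by
    rw [le_matchLen_iff (by omega) (by omega)]
    rcases Nat.eq_zero_or_pos (matchLen x y (i + 1) (j + 1)) with h | h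
    · rw [h]
      exact fun p hp => absurd hp (Nat.not_lt_zero p)
    · have := h₃.sub (c := 0) (l' := matchLen x y (i + 1) (j + 1) - 1) (by omega)
      rwa [show i + 1 - matchLen x y (i + 1) (j + 1) + 0 = i - (matchLen x y (i + 1) (j + 1) - 1)
          by omega, show j + 1 - matchLen x y (i + 1) (j + 1) + 0 =
          j - (matchLen x y (i + 1) (j + 1) - 1) by omega] at this
  omega

/-- Single characters always match, so the downward search for a length stops at `1` at the latest.
-/
theorem one_le_matchLen (i j : ℕ) : 1 ≤ matchLen x y (i + 1) (j + 1) :=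
  (le_matchLen_iff (by omega) (by omega)).2 (match_one _ _)

variable (x y k) in
/-- The value, up to a constant of the diagonal, of the best chain between the prefixes of lengths
`i` and `j` that ends with a match of length `q`. -/
noncomputable def lastValue (m i j q : ℕ) : ℕ := optLen x y k (i - q) (j - q) + m + q - i

/-- A step along the diagonal raises both `q` and `i` by one while the start of the last match stays
put. Stored values hence remain valid as the window slides. Adding `m` keeps the truncated
subtraction exact for `i ≤ m`. -/
theorem lastValue_succ (m i j q : ℕ) :
    lastValue x y k m (i + 1) (j + 1) (q + 1) = lastValue x y k m i j q := by
  simp only [lastValue, Nat.add_sub_add_right]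
  omega

theorem sup_lastValue_succ (m i j a b : ℕ) :
    (Finset.Ico (a + 1) (b + 1)).sup (lastValue x y k m (i + 1) (j + 1)) =
      (Finset.Ico a b).sup (lastValue x y k m i j) := by
  rw [← Finset.image_add_right_Ico, Finset.sup_image]
  exact Finset.sup_congr rfl fun q _ => lastValue_succ m i j q

theorem lastValue_le {m i j q : ℕ} (hi : i ≤ m) (hq : q ≤ i) : lastValue x y k m i j q ≤ m := by
  have := (optLen_le (x := x) (y := y) (k := k) (i - q) (j - q)).1
  simp only [lastValue]
  omega

theorem optLen_succ {m i : ℕ} (j : ℕ) (hm : i + 1 ≤ m) :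
    optLen x y k (i + 1) (j + 1) =
      max (max ((Finset.Ico k (matchLen x y (i + 1) (j + 1) + 1)).sup
          (lastValue x y k m (i + 1) (j + 1)) + (i + 1) - m)
        (optLen x y k i (j + 1))) (optLen x y k (i + 1) j) := by
  obtain ⟨h₁, h₂, h₃⟩ := matchLen_spec (x := x) (y := y) (i + 1) (j + 1)
  apply le_antisymm
  · have hc := chain_optLen (x := x) (y := y) (k := k) (i + 1) (j + 1)
    generalize optLen x y k (i + 1) (j + 1) = v at hc ⊢
    cases hc with
    | nil => exact Nat.zero_le _
    | @snoc a b v l _ _ h hk hi hj hm' =>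
      rcases Nat.lt_or_ge (a + l) (i + 1) with hi' | hi'
      -- If the last match stops short in one prefix, that prefix can lose its last character.
      -- Otherwise the match ends at both ends, and its starting positions are forced.
      · exact le_max_of_le_left (le_max_of_le_right
          (Chain.snoc h hk (Nat.lt_succ_iff.1 hi') hj hm').le_optLen)
      rcases Nat.lt_or_ge (b + l) (j + 1) with hj' | hj'
      · exact le_max_of_le_right (Chain.snoc h hk hi (Nat.lt_succ_iff.1 hj') hm').le_optLen
      obtain rfl : a = i + 1 - l := by omega
      obtain rfl : b = j + 1 - l := by omega
      have hl := (le_matchLen_iff (by omega) (by omega)).2 hm'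
      have hs := Finset.le_sup (f := lastValue x y k m (i + 1) (j + 1))
        (Finset.mem_Ico.2 ⟨hk, Nat.lt_add_one_iff.2 hl⟩)
      have hv := h.le_optLen
      refine le_max_of_le_left (le_max_of_le_left ?_)
      have : v + l + m - (i + 1) ≤ lastValue x y k m (i + 1) (j + 1) l := by
        simp only [lastValue]
        omega
      omega
  · refine max_le (max_le ?_ ?_) ?_
    · rcases (Finset.Ico k (matchLen x y (i + 1) (j + 1) + 1)).eq_empty_or_nonempty with h | h
      -- An empty window contributes `0`, because `i + 1 ≤ m` makes the subtraction truncate.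
      · rw [h, Finset.sup_empty, Nat.bot_eq_zero]
        omega
      · obtain ⟨q, hq, he⟩ := Finset.exists_mem_eq_sup _ h (lastValue x y k m (i + 1) (j + 1))
        rw [he]
        rw [Finset.mem_Ico] at hq
        have hm' := (le_matchLen_iff (x := x) (y := y) (i := i + 1) (j := j + 1) (l := q)
          (by omega) (by omega)).1 (by omega)
        have := (Chain.snoc (chain_optLen (k := k) (i + 1 - q) (j + 1 - q)) hq.1
          (i := i + 1) (j := j + 1) (by omega) (by omega) hm').le_optLen
        simp only [lastValue]
        omega
    · exact ((chain_optLen i (j + 1)).mono (Nat.le_succ i) le_rfl).le_optLen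
    · exact ((chain_optLen (i + 1) j).mono le_rfl (Nat.le_succ j)).le_optLen

/-! ### Extending a match by one character -/

open Classical in
/-- For a total preorder `r`, the distance from `e` to a position that is `r`-greatest among those
of the `l` positions before `e` that are `r`-below `e`; it is `0` if there are none. -/
noncomputable def near (r : ℕ → ℕ → Prop) (e : ℕ) : ℕ → ℕ
  | 0 => 0
  | l + 1 => if r (e - (l + 1)) e ∧ (near r e l = 0 ∨ r (e - near r e l) (e - (l + 1)))
      then l + 1 else near r e l

theorem near_le (r : ℕ → ℕ → Prop) (e l : ℕ) : near r e l ≤ l := by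
  induction l with
  | zero => simp [near]
  | succ l ih =>
    simp only [near]
    split_ifs <;> omega

/-- When the selected position changes, transitivity passes domination of the older positions on to
the new one. When a position below `e` is rejected, totality says that the selected one dominates
it. -/
theorem near_spec {r : ℕ → ℕ → Prop} (ht : ∀ a b c, r a b → r b c → r a c)
    (hr : ∀ a b, r a b ∨ r b a) (e l : ℕ) :
    (near r e l ≠ 0 → r (e - near r e l) e) ∧
    ∀ q, 1 ≤ q → q ≤ l → r (e - q) e → near r e l ≠ 0 ∧ r (e - q) (e - near r e l) := by
  induction l with
  | zero => exact ⟨fun h => absurd rfl h, fun q h₁ h₂ => by omega⟩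
  | succ l ih =>
    simp only [near]
    split_ifs with h
    · refine ⟨fun _ => h.1, fun q h₁ h₂ hq => ⟨by omega, ?_⟩⟩
      rcases Nat.lt_or_ge l q with h₃ | h₃
      · obtain rfl : q = l + 1 := by omega
        exact (hr _ _).elim id id
      · obtain ⟨h₄, h₅⟩ := ih.2 q h₁ h₃ hq
        exact ht _ _ _ h₅ (h.2.resolve_left h₄)
    · refine ⟨ih.1, fun q h₁ h₂ hq => ?_⟩
      rcases Nat.lt_or_ge l q with h₃ | h₃
      · obtain rfl : q = l + 1 := by omega
        have h₄ : ¬ (near r e l = 0 ∨ r (e - near r e l) (e - (l + 1))) := fun h' => h ⟨hq, h'⟩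
        rw [not_or] at h₄
        exact ⟨h₄.1, (hr _ _).resolve_right h₄.2⟩
      · exact ih.2 q h₁ h₃ hq

variable (x y)

/-- The characters at distance `d` before `e` in `x` and before `f` in `y` compare in the same way
with those at `e` and `f`. -/
def Agree (e f d : ℕ) : Prop :=
  (x (e - d) ≤ x e ↔ y (f - d) ≤ y f) ∧ (x e ≤ x (e - d) ↔ y f ≤ y (f - d))

/-- The distance to the greatest character not above `x e` among the last `l` ones. -/
noncomputable def below (e l : ℕ) : ℕ := near (fun a b => x a ≤ x b) e l

/-- The distance to the least character not below `x e` among the last `l` ones. -/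
noncomputable def above (e l : ℕ) : ℕ := near (fun a b => x b ≤ x a) e l

variable {x y}

/-- The only new comparisons are those with the appended characters. -/
theorem match_succ_iff_forall_agree {e f l : ℕ} (he : l ≤ e) (hf : l ≤ f)
    (h : Match x y (e - l) (f - l) l) :
    Match x y (e - l) (f - l) (l + 1) ↔ ∀ d, 1 ≤ d → d ≤ l → Agree x y e f d := by
  constructor
  · intro h' d h₁ h₂
    have a₁ := h' (l - d) (by omega) l (by omega)
    have a₂ := h' l (by omega) (l - d) (by omega)
    rw [show e - l + (l - d) = e - d by omega, show f - l + (l - d) = f - d by omega,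
      Nat.sub_add_cancel he, Nat.sub_add_cancel hf] at a₁ a₂
    exact ⟨a₁, a₂⟩
  · intro h' p hp q hq
    rcases Nat.lt_or_ge p l with hp' | hp' <;> rcases Nat.lt_or_ge q l with hq' | hq'
    · exact h p hp' q hq'
    · obtain rfl : q = l := by omega
      have := (h' (q - p) (by omega) (by omega)).1
      rw [Nat.sub_add_cancel he, Nat.sub_add_cancel hf]
      rwa [show e - (q - p) = e - q + p by omega, show f - (q - p) = f - q + p by omega] at this
    · obtain rfl : p = l := by omega
      have := (h' (p - q) (by omega) (by omega)).2
      rw [Nat.sub_add_cancel he, Nat.sub_add_cancel hf]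
      rwa [show e - (p - q) = e - p + q by omega, show f - (p - q) = f - p + q by omega] at this
    · obtain rfl : p = l := by omega
      obtain rfl : q = p := by omega
      simp

/-- The predecessor and successor of `x e` in the window squeeze it from both sides. The old match
carries the order of the window over to `y`, so correct comparisons with these two positions force
all the others. Equalities are covered because `Agree` compares in both directions. -/
theorem match_succ_iff {e f l : ℕ} (he : l ≤ e) (hf : l ≤ f)
    (h : Match x y (e - l) (f - l) l) :
    Match x y (e - l) (f - l) (l + 1) ↔
      Agree x y e f (below x e l) ∧ Agree x y e f (above x e l) := by
  rw [match_succ_iff_forall_agree he hf h]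
  -- Distance `0` encodes a missing neighbour; there the condition compares each new character with
  -- itself, so no case distinction is needed.
  have zero : Agree x y e f 0 := by simp [Agree]
  constructor
  · intro h'
    refine ⟨?_, ?_⟩
    · rcases Nat.eq_zero_or_pos (below x e l) with h₀ | h₀
      · rwa [h₀]
      · exact h' _ h₀ (near_le _ _ _)
    · rcases Nat.eq_zero_or_pos (above x e l) with h₀ | h₀
      · rwa [h₀]
      · exact h' _ h₀ (near_le _ _ _)
  · rintro ⟨hb, ha⟩ d h₁ h₂
    -- The old match, read in distances from the new position.
    have key : ∀ d d', 1 ≤ d → d ≤ l → 1 ≤ d' → d' ≤ l →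
        (x (e - d) ≤ x (e - d') ↔ y (f - d) ≤ y (f - d')) := by
      intro d d' h₁ h₂ h₃ h₄
      have := h (l - d) (by omega) (l - d') (by omega)
      rwa [show e - l + (l - d) = e - d by omega, show f - l + (l - d) = f - d by omega,
        show e - l + (l - d') = e - d' by omega, show f - l + (l - d') = f - d' by omega] at this
    have sb : (below x e l ≠ 0 → x (e - below x e l) ≤ x e) ∧
        ∀ q, 1 ≤ q → q ≤ l → x (e - q) ≤ x e →
          below x e l ≠ 0 ∧ x (e - q) ≤ x (e - below x e l) :=
      near_spec (r := fun a b => x a ≤ x b) (fun _ _ _ => le_trans) (fun _ _ => le_total _ _) e l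
    have sa : (above x e l ≠ 0 → x e ≤ x (e - above x e l)) ∧
        ∀ q, 1 ≤ q → q ≤ l → x e ≤ x (e - q) →
          above x e l ≠ 0 ∧ x (e - above x e l) ≤ x (e - q) :=
      near_spec (r := fun a b => x b ≤ x a) (fun _ _ _ h h' => le_trans h' h)
        (fun _ _ => le_total _ _) e l
    have lb : below x e l ≤ l := near_le _ _ _
    have la : above x e l ≤ l := near_le _ _ _
    generalize below x e l = b at *
    generalize above x e l = a at *
    -- The predecessor lies between `x (e - d)` and `x e`, and this chain transfers to `y`. If `y`
    -- has equality at the ends, it has equality throughout, and that transfers back to `x`.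
    have down : x (e - d) ≤ x e → y (f - d) ≤ y f ∧ (y f ≤ y (f - d) → x e ≤ x (e - d)) := by
      intro hd
      obtain ⟨b₀, hdb⟩ := sb.2 d h₁ h₂ hd
      have e₁ := (key d b h₁ h₂ (by omega) lb).1 hdb
      refine ⟨e₁.trans (hb.1.1 (sb.1 b₀)), fun hy => ?_⟩
      have e₂ := hb.2.2 (hy.trans e₁)
      have e₃ := (key b d (by omega) lb h₁ h₂).2 ((hb.1.1 (sb.1 b₀)).trans hy)
      exact e₂.trans e₃
    have up : x e ≤ x (e - d) → y f ≤ y (f - d) ∧ (y (f - d) ≤ y f → x (e - d) ≤ x e) := by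
      intro hd
      obtain ⟨a₀, hda⟩ := sa.2 d h₁ h₂ hd
      have e₁ := (key a d (by omega) la h₁ h₂).1 hda
      refine ⟨(ha.2.1 (sa.1 a₀)).trans e₁, fun hy => ?_⟩
      have e₂ := ha.1.2 (e₁.trans hy)
      have e₃ := (key d a h₁ h₂ (by omega) la).2 (hy.trans (ha.2.1 (sa.1 a₀)))
      exact e₃.trans e₂
    -- For the reverse implications, totality in `x` leaves only the case in which the opposite
    -- squeeze applies.
    refine ⟨⟨fun h => (down h).1, fun h => ?_⟩, ⟨fun h => (up h).1, fun h => ?_⟩⟩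
    · exact (le_total (x (e - d)) (x e)).elim id fun h' => (up h').2 h
    · exact (le_total (x e) (x (e - d))).elim id fun h' => (down h').2 h

/-- For a length `l` that is still matched at `(i, j)`, two lookups decide whether `l + 1` survives
at the next cell of the diagonal. This is the test made in each round of `shrinkRound`. -/
theorem succ_le_matchLen_iff {i j l : ℕ} (hl : l ≤ matchLen x y i j) :
    l + 1 ≤ matchLen x y (i + 1) (j + 1) ↔
      Agree x y i j (below x i l) ∧ Agree x y i j (above x i l) := by
  obtain ⟨h₁, h₂, -⟩ := matchLen_spec (x := x) (y := y) i j
  rw [le_matchLen_iff (by omega) (by omega), Nat.add_sub_add_right, Nat.add_sub_add_right]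
  exact match_succ_iff (by omega) (by omega) ((le_matchLen_iff (by omega) (by omega)).1 hl)

/-! ### Amortization -/

/-- The slack telescopes along every diagonal: each step adds one, and `f` starts at `0` on the
border and ends nonnegative. -/
theorem sum_slack_le {f : ℕ → ℕ → ℕ} (h₁ : ∀ j, f 0 j = 0) (h₂ : ∀ i, f i 0 = 0)
    (hf : ∀ i j, f (i + 1) (j + 1) ≤ f i j + 1) (m n : ℕ) :
    ∑ i ∈ Finset.range m, ∑ j ∈ Finset.range n, (f i j + 1 - f (i + 1) (j + 1)) ≤ m * n := by
  -- Shifting an index drops a border term, which is zero, and gains a nonnegative one.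
  have le₁ : ∀ i, ∑ j ∈ Finset.range n, f i j ≤ ∑ j ∈ Finset.range n, f i (j + 1) := fun i => by
    have := Finset.sum_range_succ' (f i) n
    rw [Finset.sum_range_succ, h₂] at this
    omega
  have le₂ : ∑ i ∈ Finset.range m, ∑ j ∈ Finset.range n, f i j ≤
      ∑ i ∈ Finset.range m, ∑ j ∈ Finset.range n, f (i + 1) (j + 1) := by
    refine le_trans ?_ (Finset.sum_le_sum fun i _ => le₁ (i + 1))
    have := Finset.sum_range_succ' (fun i => ∑ j ∈ Finset.range n, f i j) m
    rw [Finset.sum_range_succ] at this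
    simp only [h₁, Finset.sum_const_zero] at this
    omega
  have eq : ∑ i ∈ Finset.range m, ∑ j ∈ Finset.range n, (f i j + 1 - f (i + 1) (j + 1)) +
      ∑ i ∈ Finset.range m, ∑ j ∈ Finset.range n, f (i + 1) (j + 1) =
      ∑ i ∈ Finset.range m, ∑ j ∈ Finset.range n, f i j + m * n := by
    simp only [← Finset.sum_add_distrib, Nat.sub_add_cancel (hf _ _)]
    simp [Finset.sum_add_distrib]
  omega

/-! ### The back part of the queue along a diagonal -/

variable (x y k) in
/-- The number of entries in the back part of the queue that holds the window of the diagonal. -/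
noncomputable def backLen : ℕ → ℕ → ℕ
  | i + 1, j + 1 => if matchLen x y (i + 1) (j + 1) < backLen i j + 1 + k then 0
      else backLen i j + 1
  | _, _ => 0

theorem backLen_zero_left (j : ℕ) : backLen x y k 0 j = 0 := by simp [backLen]

theorem backLen_zero_right (i : ℕ) : backLen x y k i 0 = 0 := by cases i <;> simp [backLen]

theorem backLen_succ (i j : ℕ) : backLen x y k (i + 1) (j + 1) =
    if matchLen x y (i + 1) (j + 1) < backLen x y k i j + 1 + k then 0
      else backLen x y k i j + 1 := by
  simp [backLen]

theorem backLen_le (i j : ℕ) : backLen x y k i j ≤ i := by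
  induction i generalizing j with
  | zero => simp [backLen]
  | succ i ih =>
    cases j with
    | zero => simp [backLen]
    | succ j =>
      have := ih j
      rw [backLen_succ]
      split_ifs <;> omega

variable (x y k) in
/-- The best value in the back part of the queue. -/
noncomputable def backMax (m i j : ℕ) : ℕ :=
  (Finset.Ico k (k + backLen x y k i j)).sup (lastValue x y k m i j)

theorem matchLen_zero_left (j : ℕ) : matchLen x y 0 j = 0 :=
  Nat.le_zero.1 (matchLen_spec 0 j).1

theorem matchLen_zero_right (i : ℕ) : matchLen x y i 0 = 0 :=
  Nat.le_zero.1 (matchLen_spec i 0).2.1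

theorem optLen_zero_left (j : ℕ) : optLen x y k 0 j = 0 :=
  Nat.le_zero.1 (optLen_le 0 j).1

theorem optLen_zero_right (i : ℕ) : optLen x y k i 0 = 0 :=
  Nat.le_zero.1 (optLen_le i 0).2

end Combinatorics

/-! ### The program: layout and tables of neighbours

Registers: `2` to `6` hold `k`, the lengths `m ≤ n` of the two strings and their offsets in the
input, `7` to `11` hold `1`, `n + 1`, `8 * (n + 2)`, `0` and `8`. The memory is a table of records
of eight cells, indexed by `i ≤ m` and `j ≤ n`. -/

infixr:60 " ;; " => Program.seq

/-- The address of field `f` of the record `(i, j)`. -/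
def cell (n i j f : ℕ) : ℕ := 8 * (i * (n + 1) + j) + f

theorem cell_inj {n i j f i' j' f' : ℕ} (hj : j ≤ n) (hj' : j' ≤ n) (hf : f < 8) (hf' : f' < 8) :
    cell n i j f = cell n i' j' f' ↔ i = i' ∧ j = j' ∧ f = f' := by
  constructor
  · intro h
    simp only [cell] at h
    obtain rfl : f = f' := by omega
    have h' : i * (n + 1) + j = i' * (n + 1) + j' := by omega
    have hi : i = i' := by
      have := congrArg (· / (n + 1)) h'
      simpa [Nat.add_comm _ j, Nat.add_comm _ j', Nat.add_mul_div_right,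
        Nat.div_eq_of_lt (Nat.lt_succ_of_le hj), Nat.div_eq_of_lt (Nat.lt_succ_of_le hj')] using this
    subst hi
    exact ⟨rfl, by omega, rfl⟩
  · rintro ⟨rfl, rfl, rfl⟩
    rfl

theorem cell_lt {m n i j f : ℕ} (hi : i ≤ m) (hj : j ≤ n) (hf : f < 8) :
    cell n i j f < 8 * ((m + 1) * (n + 1)) := by
  have : i * (n + 1) ≤ m * (n + 1) := Nat.mul_le_mul_right _ hi
  simp only [cell, Nat.succ_mul]
  omega

theorem cell_succ_left (n i j f : ℕ) : cell n (i + 1) j f = cell n i j f + 8 * (n + 1) := by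
  simp only [cell, Nat.succ_mul]
  omega

theorem cell_succ_right (n i j f : ℕ) : cell n i (j + 1) f = cell n i j f + 8 := by
  simp only [cell]
  omega

theorem cell_add (n i j f g : ℕ) : cell n i j (f + g) = cell n i j f + g := by
  simp only [cell]
  omega

/-- One diagonal step is a fixed address difference. The additive form also shows that the product
`q * (8 * (n + 2))` computed by the program is no larger than an address. -/
theorem cell_diag (n f : ℕ) {i j q : ℕ} (hi : q ≤ i) (hj : q ≤ j) :
    cell n (i - q) (j - q) f + q * (8 * (n + 2)) = cell n i j f := by
  obtain ⟨i, rfl⟩ := Nat.exists_eq_add_of_le hi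
  obtain ⟨j, rfl⟩ := Nat.exists_eq_add_of_le hj
  simp only [Nat.add_sub_cancel_left, cell]
  ring

section Layout

variable {α : Type u} [LinearOrder α]

/-- The strings sit in the input, and the machine is large enough for the program. -/
structure Setting (inp : List α) (S W k m n ox oy : ℕ) (x y : ℕ → α) : Prop where
  hx : ∀ i < m, inp[ox + i]? = some (x i)
  hy : ∀ j < n, inp[oy + j]? = some (y j)
  pos : 1 ≤ k
  le : m ≤ n
  space : 8 * ((m + 1) * (n + 1)) ≤ S
  word : 16 * ((m + 1) * (n + 1)) + ox + oy + 4 * m + 4 * n + 2 * k + 100 ≤ W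

/-- The registers that the program keeps fixed have the right contents. -/
structure Consts (k m n ox oy : ℕ) (σ : State) : Prop where
  r2 : σ.reg 2 = k
  r3 : σ.reg 3 = m
  r4 : σ.reg 4 = n
  r5 : σ.reg 5 = ox
  r6 : σ.reg 6 = oy
  r7 : σ.reg 7 = 1
  r8 : σ.reg 8 = n + 1
  r9 : σ.reg 9 = 8 * (n + 2)
  r10 : σ.reg 10 = 0
  r11 : σ.reg 11 = 8

/-- The states differ at most in the registers from `d` on. -/
def SameBelow (d : ℕ) (σ τ : State) : Prop := ∀ r < d, τ.reg r = σ.reg r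

theorem SameBelow.refl (d : ℕ) (σ : State) : SameBelow d σ σ := fun _ _ => rfl

theorem SameBelow.trans {d : ℕ} {σ τ υ : State} (h : SameBelow d σ τ) (h' : SameBelow d τ υ) :
    SameBelow d σ υ := fun r hr => (h' r hr).trans (h r hr)

theorem SameBelow.mono {d d' : ℕ} {σ τ : State} (h : SameBelow d σ τ) (hd : d' ≤ d) :
    SameBelow d' σ τ := fun r hr => h r (hr.trans_le hd)

theorem SameBelow.setReg {d r v : ℕ} {σ τ : State} (h : SameBelow d σ τ) (hr : d ≤ r) :
    SameBelow d σ (τ.setReg r v) := fun s hs => by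
  simp [show s ≠ r by omega, h s hs]

theorem SameBelow.setMem {d a v : ℕ} {σ τ : State} (h : SameBelow d σ τ) :
    SameBelow d σ (τ.setMem a v) := h

theorem Consts.of_sameBelow {k m n ox oy d : ℕ} {σ τ : State} (h : Consts k m n ox oy σ)
    (hd : 12 ≤ d) (hs : SameBelow d σ τ) : Consts k m n ox oy τ := by
  constructor <;> rw [hs _ (by omega)]
  exacts [h.r2, h.r3, h.r4, h.r5, h.r6, h.r7, h.r8, h.r9, h.r10, h.r11]

theorem Consts.setReg {k m n ox oy d v : ℕ} {σ : State} (h : Consts k m n ox oy σ)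
    (hd : 12 ≤ d) : Consts k m n ox oy (σ.setReg d v) :=
  h.of_sameBelow le_rfl fun r hr => by simp [show r ≠ d by omega]

theorem Consts.setMem {k m n ox oy a v : ℕ} {σ : State} (h : Consts k m n ox oy σ) :
    Consts k m n ox oy (σ.setMem a v) :=
  h.of_sameBelow le_rfl fun _ _ => rfl

/-- Update the distance in register `d` for the position in register `20`, at the distance in
register `13` before the position in register `21`. -/
def updateNear (d : ℕ) (b₁ b₂ : Test) : Program :=
  .ite b₁
    (.ite (.eq d 10) (.assign d (.reg 13))
      (.assign 22 (.sub 21 d) ;; .ite b₂ (.assign d (.reg 13)) .skip))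
    .skip

theorem wp_updateNear {inp : List α} {S W d e l o : ℕ} {b₁ b₂ : Test} {σ : State}
    {r : ℕ → ℕ → Prop}
    (h10 : σ.reg 10 = 0) (h13 : σ.reg 13 = l + 1) (h21 : σ.reg 21 = o + e)
    (hd : σ.reg d = near r e l) (hW : o + e < W) (hl : l + 1 ≤ e) (hd' : d ≠ 22) (hd13 : d ≠ 13)
    (l₁ : b₁.Legal inp σ) (p₁ : b₁.Holds inp σ ↔ r (e - (l + 1)) e)
    (l₂ : b₂.Legal inp (σ.setReg 22 (o + (e - near r e l))))
    (p₂ : b₂.Holds inp (σ.setReg 22 (o + (e - near r e l))) ↔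
      r (e - near r e l) (e - (l + 1))) :
    Wp inp S W (updateNear d b₁ b₂) σ fun t τ => t ≤ 5 ∧ τ.mem = σ.mem ∧
      τ.reg d = near r e (l + 1) ∧ ∀ s, s ≠ d → s ≠ 22 → τ.reg s = σ.reg s := by
  have hn := near_le r e l
  have h22 : o + e - near r e l = o + (e - near r e l) := by omega
  have h13d : ¬ 13 = d := fun h => hd13 h.symm
  simp only [updateNear, Wp.ite_iff, Wp.seq_iff, Wp.assign_iff, Wp.skip_iff, Expr.value, p₁,
    State.setReg_reg, h13, h21, hd, h10, h22, p₂, Test.eq_legal_iff, Test.eq_holds_iff]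
  refine ⟨l₁, fun h₁ => ⟨trivial, fun h₂ => ⟨by omega, by omega, rfl, ?_, ?_⟩, fun h₂ =>
    ⟨by omega, l₂, fun h₃ => ⟨?_, ?_, rfl, ?_, ?_⟩, fun h₃ => ⟨by omega, rfl, ?_, ?_⟩⟩⟩,
    fun h₁ => ⟨by omega, trivial, ?_, fun _ _ _ => trivial⟩⟩
  · simp [near, h₁, h₂]
  · intro s hs hs'
    simp [hs]
  · simp; omega
  · simp
  · simp [near, h₁, h₃]
  · intro s hs hs'
    simp [hs, hs']
  · simp [near, h₁, h₂, h₃, hd']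
  · intro s hs hs'
    simp [hs']
  · simp [near, h₁]

/-- Enter the distances for the next window of the row. -/
def tableRound : Program :=
  .assign 13 (.add 13 7) ;; .assign 15 (.add 15 11) ;; .assign 20 (.sub 21 13) ;;
  updateNear 16 (.charLe 20 21) (.charLe 22 20) ;;
  updateNear 17 (.charLe 21 20) (.charLe 20 22) ;;
  .store 15 16 ;; .assign 22 (.add 15 7) ;; .store 22 17

/-- Enter the distances for all windows that end before one position. -/
def tableRow : Program :=
  .assign 13 (.const 0) ;; .assign 16 (.const 0) ;; .assign 17 (.const 0) ;;
  .assign 21 (.add 5 12) ;; .assign 15 (.mul 12 8) ;; .assign 15 (.mul 15 11) ;;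
  .while (.lt 13 12) tableRound ;; .assign 12 (.add 12 7)

/-- Enter all distances. -/
def table : Program := .assign 12 (.const 0) ;; .while (.lt 12 3) tableRow

/-- The distances are correct in the rows before `e`, and up to `l` in row `e`. -/
structure TableInv (m n : ℕ) (x : ℕ → α) (e l : ℕ) (mem : ℕ → ℕ) : Prop where
  near : ∀ e' l', e' < m → l' ≤ e' → (e' < e ∨ (e' = e ∧ l' ≤ l) ∨ l' = 0) →
    mem (cell n e' l' 0) = below x e' l' ∧ mem (cell n e' l' 1) = above x e' l'
  rest : ∀ i j f, 2 ≤ f → f < 8 → mem (cell n i j f) = 0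

/-- The invariant of the loop over the windows. -/
structure RoundInv (k m n ox oy : ℕ) (x : ℕ → α) (e l : ℕ) (σ : State) : Prop where
  consts : Consts k m n ox oy σ
  r12 : σ.reg 12 = e
  r13 : σ.reg 13 = l
  r15 : σ.reg 15 = cell n e l 0
  r16 : σ.reg 16 = below x e l
  r17 : σ.reg 17 = above x e l
  r21 : σ.reg 21 = ox + e
  mem : TableInv m n x e l σ.mem

variable {inp : List α} {S W k m n ox oy : ℕ} {x y : ℕ → α}

/-- Both entries go into the record `(e, l + 1)`, whose index fits the table because `l + 1 ≤ e < m
≤ n`. -/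
theorem TableInv.step {e l : ℕ} {mem : ℕ → ℕ} (h : TableInv m n x e l mem) (hmn : m ≤ n)
    (he : e < m) (hl : l < e) :
    TableInv m n x e (l + 1) fun a => if a = cell n e (l + 1) 1 then above x e (l + 1)
      else if a = cell n e (l + 1) 0 then below x e (l + 1) else mem a := by
  constructor
  · intro e' l' he' hl' hc
    simp only [cell_inj (n := n) (j := l') (j' := l + 1) (by omega) (by omega) (Nat.zero_lt_succ 7)
      (Nat.zero_lt_succ 7), cell_inj (n := n) (j := l') (j' := l + 1) (f := 1) (f' := 0) (by omega)
      (by omega) (by omega) (by omega), cell_inj (n := n) (j := l') (j' := l + 1) (f := 0) (f' := 1)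
      (by omega) (by omega) (by omega) (by omega), cell_inj (n := n) (j := l') (j' := l + 1)
      (f := 1) (f' := 1) (by omega) (by omega) (by omega) (by omega)]
    by_cases h' : e' = e ∧ l' = l + 1
    · obtain ⟨rfl, rfl⟩ := h'
      simp
    · have := h.near e' l' he' hl' (by omega)
      rw [not_and] at h'
      by_cases he : e' = e
      · simpa [h' he] using this
      · simpa [he] using this
  · intro i j f hf hf'
    have h₁ : cell n i j f ≠ cell n e (l + 1) 1 := by simp only [cell]; omega
    have h₀ : cell n i j f ≠ cell n e (l + 1) 0 := by simp only [cell]; omega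
    simp [h₁, h₀, h.rest i j f hf hf']

/-- The neighbours in a window of length `l + 1` come from those of length `l` by testing the one
new position, so each table entry costs a constant. The bound `17` is six elementary instructions,
two updates of at most five steps, and the loop test. -/
theorem wp_tableRound (hs : Setting inp S W k m n ox oy x y) {e l : ℕ} {σ : State}
    (he : e < m) (hl : l < e) (h : RoundInv k m n ox oy x e l σ) :
    Wp inp S W tableRound σ fun t τ => RoundInv k m n ox oy x e (l + 1) τ ∧ t + 1 ≤ 17 := by
  have hmn := hs.le
  have hword := hs.word
  have hcell := cell_succ_right n e l 0
  have hlt := cell_lt (n := n) (m := m) (i := e) (j := l + 1) (f := 1) (by omega) (by omega)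
    (by omega)
  have hlt' : cell n e (l + 1) 1 = cell n e (l + 1) 0 + 1 := cell_add n e (l + 1) 0 1
  have hsp := hs.space
  simp only [tableRound, Wp.seq_iff, Wp.assign_iff, Expr.value, State.setReg_reg, h.r13,
    h.consts.r7, h.r15, h.consts.r11, h.r21, Nat.reduceEqDiff, if_true,
    if_false]
  have hq : ox + e - (l + 1) = ox + (e - (l + 1)) := by omega
  refine ⟨by omega, by omega, by omega, ?_⟩
  have lb : below x e l ≤ l := near_le _ _ _
  have la : above x e l ≤ l := near_le _ _ _
  have hxe := hs.hx e he
  have hxq := hs.hx (e - (l + 1)) (by omega)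
  have hxb := hs.hx (e - below x e l) (by omega)
  have hxa := hs.hx (e - above x e l) (by omega)
  refine (wp_updateNear (e := e) (l := l) (o := ox) (r := fun a b => x a ≤ x b) (by simp [h.consts.r10])
    (by simp) (by simp [h.r21]) (by simpa [below] using h.r16) (by omega) hl (by decide) (by decide)
    (charLe_legal (by simpa [hq] using hxq) (by simpa [h.r21] using hxe))
    (charLe_holds_iff (by simpa [hq] using hxq) (by simpa [h.r21] using hxe))
    (charLe_legal (by simpa [below] using hxb) (by simpa [hq] using hxq))
    (charLe_holds_iff (by simpa [below] using hxb) (by simpa [hq] using hxq))).mono ?_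
  rintro t₁ σ₁ ⟨ht₁, hm₁, hd₁, hr₁⟩
  have q13 : σ₁.reg 13 = l + 1 := by rw [hr₁ _ (by decide) (by decide)]; simp
  have q21 : σ₁.reg 21 = ox + e := by rw [hr₁ _ (by decide) (by decide)]; simp [h.r21]
  have q20 : σ₁.reg 20 = ox + (e - (l + 1)) := by
    rw [hr₁ _ (by decide) (by decide)]; simp [hq]
  refine (wp_updateNear (e := e) (l := l) (o := ox) (r := fun a b => x b ≤ x a)
    (by rw [hr₁ _ (by decide) (by decide)]; simp [h.consts.r10])
    q13 q21 (by rw [hr₁ _ (by decide) (by decide)]; simpa [above] using h.r17) (by omega) hl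
    (by decide) (by decide)
    (charLe_legal (by simpa [q21] using hxe) (by simpa [q20] using hxq))
    (charLe_holds_iff (by simpa [q21] using hxe) (by simpa [q20] using hxq))
    (charLe_legal (by simpa [q20] using hxq) (by simpa [above] using hxa))
    (charLe_holds_iff (by simpa [q20] using hxq) (by simpa [above] using hxa))).mono ?_
  rintro t₂ σ₂ ⟨ht₂, hm₂, hd₂, hr₂⟩
  have q₂ : ∀ r, r ≠ 13 → r ≠ 15 → r ≠ 16 → r ≠ 17 → r ≠ 20 → r ≠ 22 → σ₂.reg r = σ.reg r := by
    intro r h13 h15 h16 h17 h20 h22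
    rw [hr₂ r h17 h22, hr₁ r h16 h22]
    simp [h13, h15, h20]
  have q15 : σ₂.reg 15 = cell n e (l + 1) 0 := by
    rw [hr₂ _ (by decide) (by decide), hr₁ _ (by decide) (by decide)]
    simp [hcell]
  have q7 : σ₂.reg 7 = 1 := by
    rw [q₂ _ (by decide) (by decide) (by decide) (by decide) (by decide) (by decide), h.consts.r7]
  have q16 : σ₂.reg 16 = below x e (l + 1) := by rw [hr₂ _ (by decide) (by decide), hd₁, below]
  have q17 : σ₂.reg 17 = above x e (l + 1) := by rw [hd₂, above]
  simp only [Wp.store_iff, State.setReg_reg, State.setMem_reg, q15, q16, q17, q7, Nat.reduceEqDiff, if_true, if_false, ← hlt']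
  refine ⟨by omega, by omega, by omega, ?_, by omega⟩
  constructor
  · refine Consts.setMem (Consts.setReg (Consts.setMem ?_) (by decide))
    exact h.consts.of_sameBelow le_rfl fun r hr => q₂ r (by omega) (by omega) (by omega) (by omega)
      (by omega) (by omega)
  · simpa using (q₂ 12 (by decide) (by decide) (by decide) (by decide) (by decide)
      (by decide)).trans h.r12
  · simp [hr₂ 13 (by decide) (by decide), q13]
  · simpa using q15
  · simpa using q16
  · simpa using q17
  · simpa [hr₂ 21 (by decide) (by decide)] using q21
  · have := h.mem.step hmn he hl
    convert this using 2 with a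
    simp [hm₂, hm₁]

theorem wp_tableRow (hs : Setting inp S W k m n ox oy x y) {e : ℕ} {σ : State} (he : e < m)
    (hc : Consts k m n ox oy σ) (h12 : σ.reg 12 = e) (hm : TableInv m n x e 0 σ.mem) :
    Wp inp S W tableRow σ fun t τ => (Consts k m n ox oy τ ∧ τ.reg 12 = e + 1 ∧
      TableInv m n x (e + 1) 0 τ.mem) ∧ t + 1 ≤ 17 * m + 20 := by
  have hmn := hs.le
  have hword := hs.word
  have hcell : e * (n + 1) * 8 = cell n e 0 0 := by simp only [cell]; ring
  have hlt := cell_lt (n := n) (m := m) (i := e) (j := 0) (f := 0) (by omega) (by omega)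
    (by omega)
  have hle : e * (n + 1) ≤ e * (n + 1) * 8 := by omega
  simp only [tableRow, Wp.seq_iff, Wp.assign_iff, Expr.value, State.setReg_reg,
    h12, hc.r5, hc.r8, hc.r11, Nat.reduceEqDiff, if_true, if_false, hcell]
  refine ⟨by omega, by omega, by omega, by omega, by omega, by omega, ?_⟩
  refine (Wp.while_lt (RoundInv k m n ox oy x e) (fun _ => 17) (N := e)
    (fun i σ h => ⟨h.r13, h.r12⟩) (fun i σ hi h => wp_tableRound hs he hi h) (Nat.zero_le e)
    ?_).mono ?_
  · constructor
    · repeat' apply Consts.setReg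
      all_goals first | exact hc | decide
    · simpa using h12
    · simp
    · simp
    · simp [below, near]
    · simp [above, near]
    · simp
    · simpa using hm
  · rintro t τ ⟨h, ht⟩
    simp only [Finset.sum_const, Nat.card_Ico, smul_eq_mul] at ht
    simp only [h.r12, h.consts.r7]
    refine ⟨by omega, ⟨h.consts.setReg (by decide), by simp, ?_⟩, by omega⟩
    refine ⟨fun e' l' he' hl' hc' => h.mem.near e' l' he' hl' (by omega), h.mem.rest⟩

theorem wp_table (hs : Setting inp S W k m n ox oy x y) {σ : State}
    (hc : Consts k m n ox oy σ) (hm : ∀ a, σ.mem a = 0) :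
    Wp inp S W table σ fun t τ => Consts k m n ox oy τ ∧ TableInv m n x m 0 τ.mem ∧
      t ≤ m * (17 * m + 20) + 2 := by
  have hword := hs.word
  simp only [table, Wp.seq_iff, Wp.assign_iff, Expr.value]
  refine ⟨by omega, ?_⟩
  refine (Wp.while_lt (fun e τ => Consts k m n ox oy τ ∧ τ.reg 12 = e ∧
    TableInv m n x e 0 τ.mem) (fun _ => 17 * m + 20) (N := m)
    (fun i σ h => ⟨h.2.1, h.1.r3⟩) (fun i σ hi h => wp_tableRow hs hi h.1 h.2.1 h.2.2)
    (Nat.zero_le m) ⟨hc.setReg (by decide), by simp, ?_⟩).mono ?_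
  · constructor
    -- Empty windows have no neighbours, and the zeros of the initial memory already say so.
    · intro e' l' _ _ h
      obtain rfl : l' = 0 := by omega
      simp [hm, below, above, near]
    · simp [hm]
  · rintro t τ ⟨h, ht⟩
    simp only [Finset.sum_const, Nat.card_Ico, smul_eq_mul, Nat.sub_zero] at ht
    exact ⟨h.1, h.2.2, by omega⟩

end Layout

/-! ### The program: longest matches -/

section Matching

variable {α : Type u} [LinearOrder α] {inp : List α} {S W k m n ox oy : ℕ} {x y : ℕ → α}

/-- Clear the flag if the two tests have different outcomes. -/
def compareTests (b c : Test) : Program :=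
  .ite b (.ite c .skip (.assign 32 (.const 0))) (.ite c (.assign 32 (.const 0)) .skip)

/-- Clear the flag if the characters at the distance in register `23` disagree. -/
def checkAgree : Program :=
  .assign 24 (.sub 21 23) ;; .assign 25 (.sub 22 23) ;;
  compareTests (.charLe 24 21) (.charLe 25 22) ;; compareTests (.charLe 21 24) (.charLe 22 25)

/-- Try the next shorter match length. -/
def shrinkRound : Program :=
  .assign 18 (.sub 18 7) ;; .assign 20 (.mul 18 11) ;; .assign 20 (.add 14 20) ;;
  .assign 20 (.sub 20 11) ;; .load 23 20 ;; .assign 32 (.reg 7) ;; checkAgree ;;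
  .assign 20 (.add 20 7) ;; .load 23 20 ;; checkAgree

/-- Load field `f` of the record whose address is in register `r` into register `d`. -/
def loadField (d r f : ℕ) : Program :=
  .assign 26 (.const f) ;; .assign 26 (.add r 26) ;; .load d 26

/-- Store register `s` in field `f` of the record whose address is in register `r`. -/
def storeField (r f s : ℕ) : Program :=
  .assign 26 (.const f) ;; .assign 26 (.add r 26) ;; .store 26 s

/-- Compute the length of the longest match that ends at the current cell. -/
def matching : Program :=
  loadField 18 15 3 ;; .assign 18 (.add 18 7) ;; .assign 18 (.add 18 7) ;;
  .assign 32 (.const 0) ;; .assign 21 (.add 5 12) ;; .assign 22 (.add 6 13) ;;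
  .while (.eq 32 10) shrinkRound

omit [LinearOrder α] in
theorem wp_compareTests [LE α] {b c : Test} {p q : Prop} {σ : State}
    (lb : b.Legal inp σ) (hb : b.Holds inp σ ↔ p) (lc : c.Legal inp σ) (hc : c.Holds inp σ ↔ q)
    (hW : 0 < W) :
    Wp inp S W (compareTests b c) σ fun t τ => t ≤ 3 ∧ τ.mem = σ.mem ∧
      (∀ r, r ≠ 32 → τ.reg r = σ.reg r) ∧ ((p ↔ q) → τ.reg 32 = σ.reg 32) ∧
      (¬ (p ↔ q) → τ.reg 32 = 0) := by
  simp only [compareTests, Wp.ite_iff, Wp.skip_iff, Wp.assign_iff, hb, hc, Expr.value, State.setReg_reg,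
    State.setReg_mem, if_true]
  refine ⟨lb, fun hp => ⟨lc, fun hq => ?_, fun hq => ?_⟩,
    fun hp => ⟨lc, fun hq => ?_, fun hq => ?_⟩⟩ <;>
  simp +contextual [hp, hq, hW]

theorem wp_checkAgree (hs : Setting inp S W k m n ox oy x y) {i j d : ℕ} {σ : State}
    (hi : i < m) (hj : j < n) (h21 : σ.reg 21 = ox + i) (h22 : σ.reg 22 = oy + j)
    (h23 : σ.reg 23 = d) (hdi : d ≤ i) (hdj : d ≤ j) :
    Wp inp S W checkAgree σ fun t τ => t ≤ 8 ∧ τ.mem = σ.mem ∧ SameBelow 24 σ τ ∧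
      (Agree x y i j d → τ.reg 32 = σ.reg 32) ∧ (¬ Agree x y i j d → τ.reg 32 = 0) := by
  have hword := hs.word
  have ei : ox + i - d = ox + (i - d) := by omega
  have ej : oy + j - d = oy + (j - d) := by omega
  simp only [checkAgree, Wp.seq_iff, Wp.assign_iff, Expr.value, State.setReg_reg, h21, h22, h23,
    Nat.reduceEqDiff, if_false, ei, ej]
  refine ⟨by omega, by omega, ?_⟩
  have hxe := hs.hx i hi
  have hxd := hs.hx (i - d) (by omega)
  have hye := hs.hy j hj
  have hyd := hs.hy (j - d) (by omega)
  refine (wp_compareTests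
    (charLe_legal (by simpa using hxd) (by simpa [h21] using hxe))
    (charLe_holds_iff (by simpa using hxd) (by simpa [h21] using hxe))
    (charLe_legal (by simpa using hyd) (by simpa [h22] using hye))
    (charLe_holds_iff (by simpa using hyd) (by simpa [h22] using hye)) (by omega)).mono ?_
  rintro t₁ σ₁ ⟨ht₁, hm₁, hr₁, hp₁, hn₁⟩
  have g21 : σ₁.reg 21 = ox + i := by rw [hr₁ _ (by decide)]; simpa using h21
  have g22 : σ₁.reg 22 = oy + j := by rw [hr₁ _ (by decide)]; simpa using h22
  have g24 : σ₁.reg 24 = ox + (i - d) := by rw [hr₁ _ (by decide)]; simp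
  have g25 : σ₁.reg 25 = oy + (j - d) := by rw [hr₁ _ (by decide)]; simp
  rw [← g24] at hxd
  rw [← g25] at hyd
  rw [← g21] at hxe
  rw [← g22] at hye
  refine (wp_compareTests
    (charLe_legal hxe hxd) (charLe_holds_iff hxe hxd)
    (charLe_legal hye hyd) (charLe_holds_iff hye hyd) (by omega)).mono ?_
  rintro t₂ σ₂ ⟨ht₂, hm₂, hr₂, hp₂, hn₂⟩
  have e32 : ((σ.setReg 24 (ox + (i - d))).setReg 25 (oy + (j - d))).reg 32 = σ.reg 32 := by simp
  rw [e32] at hp₁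
  refine ⟨by omega, by rw [hm₂, hm₁]; rfl, ?_, fun h => ?_, fun h => ?_⟩
  · intro r hr
    rw [hr₂ r (by omega), hr₁ r (by omega)]
    simp [show r ≠ 24 by omega, show r ≠ 25 by omega]
  · rw [hp₂ h.2, hp₁ h.1]
  · by_cases h' : x i ≤ x (i - d) ↔ y j ≤ y (j - d)
    · rw [hp₂ h']
      exact hn₁ fun h₁ => h ⟨h₁, h'⟩
    · exact hn₂ h'

/-- The invariant of the loop that shrinks the match. -/
structure ShrinkInv (ox oy : ℕ) (x y : ℕ → α) (i j : ℕ) (σ₀ σ : State) : Prop where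
  same : SameBelow 18 σ₀ σ
  mem : σ.mem = σ₀.mem
  r21 : σ.reg 21 = ox + i
  r22 : σ.reg 22 = oy + j
  flag : (σ.reg 32 = 0 ∧ matchLen x y (i + 1) (j + 1) + 1 ≤ σ.reg 18 ∧
      σ.reg 18 ≤ matchLen x y i j + 2) ∨
    (σ.reg 32 = 1 ∧ σ.reg 18 = matchLen x y (i + 1) (j + 1))

/-- A flag `0` records that all lengths from register `18` upwards have been refuted. The round
decides the next smaller one with the two tabulated neighbours. -/
theorem wp_shrinkRound (hs : Setting inp S W k m n ox oy x y) {i j : ℕ} {σ₀ σ : State}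
    (hi : i < m) (hj : j < n) (hc : Consts k m n ox oy σ₀) (h14 : σ₀.reg 14 = cell n i 0 0)
    (hm : ∀ l ≤ i, σ₀.mem (cell n i l 0) = below x i l ∧ σ₀.mem (cell n i l 1) = above x i l)
    (h : ShrinkInv ox oy x y i j σ₀ σ) (h0 : σ.reg 32 = 0) :
    Wp inp S W shrinkRound σ fun t τ => ShrinkInv ox oy x y i j σ₀ τ ∧
      τ.reg 18 + 1 = σ.reg 18 ∧ t ≤ 24 := by
  have hword := hs.word
  have hmn := hs.le
  obtain ⟨hL₁, hL₂, -⟩ := matchLen_spec (x := x) (y := y) i j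
  have hL' := one_le_matchLen (x := x) (y := y) i j
  obtain ⟨-, hl₁, hl₂⟩ | h1 := h.flag
  swap
  · omega
  -- Register `18` is at least `2` since some positive length always survives. The round tests `l +
  -- 1`, using the neighbours for windows of length `l`.
  obtain ⟨l, hl⟩ : ∃ l, σ.reg 18 = l + 2 := ⟨σ.reg 18 - 2, by omega⟩
  have hcl : cell n i 0 0 + (l + 1) * 8 - 8 = cell n i l 0 := by simp only [cell]; omega
  have hlt := cell_lt (n := n) (m := m) (i := i) (j := l + 1) (f := 0) (by omega) (by omega)
    (by omega)
  have hlt' : cell n i 0 0 + (l + 1) * 8 = cell n i (l + 1) 0 := by simp only [cell]; omega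
  have hlt1 : cell n i l 0 + 1 = cell n i l 1 := rfl
  have hlt2 := cell_succ_right n i l 0
  have hsp := hs.space
  have hml := hm l (by omega)
  have hba : below x i l ≤ l := near_le _ _ _
  have hab : above x i l ≤ l := near_le _ _ _
  have hsub : l + 2 - 1 = l + 1 := rfl
  simp only [shrinkRound, Wp.seq_iff, Wp.assign_iff, Wp.load_iff, Expr.value, State.setReg_reg,
    State.setReg_mem, hl, h.same 7 (by decide), h.same 11 (by decide), h.same 14 (by decide),
    hc.r7, hc.r11, h14, Nat.reduceEqDiff, if_true, if_false, hcl, hsub, h.mem]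
  refine ⟨by omega, by omega, by omega, by omega, by omega, by omega, ?_⟩
  refine (wp_checkAgree hs hi hj (d := below x i l) (by simpa using h.r21) (by simpa using h.r22)
    (by simpa using hml.1) (by omega) (by omega)).mono ?_
  rintro t₁ σ₁ ⟨ht₁, hm₁, hr₁, hp₁, hn₁⟩
  have g20 : σ₁.reg 20 = cell n i l 0 := by rw [hr₁ _ (by decide)]; simp
  have g7 : σ₁.reg 7 = 1 := by
    rw [hr₁ _ (by decide)]; simp [h.same 7 (by decide), hc.r7]
  have g21 : σ₁.reg 21 = ox + i := by rw [hr₁ _ (by decide)]; simpa using h.r21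
  have g22 : σ₁.reg 22 = oy + j := by rw [hr₁ _ (by decide)]; simpa using h.r22
  have gm : σ₁.mem = σ₀.mem := hm₁.trans h.mem
  simp only [g20, g7, hlt1, gm]
  refine ⟨by omega, by omega, ?_⟩
  refine (wp_checkAgree hs hi hj (d := above x i l) (by simpa using g21) (by simpa using g22)
    (by simpa using hml.2) (by omega) (by omega)).mono ?_
  rintro t₂ σ₂ ⟨ht₂, hm₂, hr₂, hp₂, hn₂⟩
  have f18 : σ₂.reg 18 = l + 1 := by
    rw [hr₂ _ (by decide)]
    simp [hr₁ 18 (by decide)]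
  refine ⟨⟨fun r hr => ?_, by rw [hm₂]; exact gm, ?_, ?_, ?_⟩, by omega, by omega⟩
  · rw [hr₂ r (by omega)]
    simp [show r ≠ 23 by omega, show r ≠ 20 by omega, hr₁ r (by omega), show r ≠ 18 by omega,
      show r ≠ 32 by omega, h.same r hr]
  · rw [hr₂ _ (by decide)]; simpa using g21
  · rw [hr₂ _ (by decide)]; simpa using g22
  · have hiff := succ_le_matchLen_iff (x := x) (y := y) (i := i) (j := j) (l := l) (by omega)
    rw [f18]
    simp at hp₁ hp₂
    by_cases hA : Agree x y i j (below x i l)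
    · by_cases hB : Agree x y i j (above x i l)
      · have := hiff.2 ⟨hA, hB⟩
        exact Or.inr ⟨by rw [hp₂ hB, hp₁ hA], by omega⟩
      · have : ¬ (l + 1 ≤ matchLen x y (i + 1) (j + 1)) := fun h => hB (hiff.1 h).2
        exact Or.inl ⟨hn₂ hB, by omega, by omega⟩
    · have : ¬ (l + 1 ≤ matchLen x y (i + 1) (j + 1)) := fun h => hA (hiff.1 h).1
      refine Or.inl ⟨?_, by omega, by omega⟩
      by_cases hB : Agree x y i j (above x i l)
      · rw [hp₂ hB, hn₁ hA]
      · exact hn₂ hB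

theorem wp_matching (hs : Setting inp S W k m n ox oy x y) {i j : ℕ} {σ : State}
    (hi : i < m) (hj : j < n) (hc : Consts k m n ox oy σ) (h12 : σ.reg 12 = i)
    (h13 : σ.reg 13 = j) (h14 : σ.reg 14 = cell n i 0 0) (h15 : σ.reg 15 = cell n i j 0)
    (hm : ∀ l ≤ i, σ.mem (cell n i l 0) = below x i l ∧ σ.mem (cell n i l 1) = above x i l)
    (hL : σ.mem (cell n i j 3) = matchLen x y i j) :
    Wp inp S W matching σ fun t τ =>
      t ≤ 25 * (matchLen x y i j + 1 - matchLen x y (i + 1) (j + 1)) + 34 ∧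
      SameBelow 18 σ τ ∧ τ.mem = σ.mem ∧ τ.reg 18 = matchLen x y (i + 1) (j + 1) := by
  have hword := hs.word
  have hsp := hs.space
  have hmn := hs.le
  obtain ⟨hL₁, hL₂, -⟩ := matchLen_spec (x := x) (y := y) i j
  have hle := matchLen_succ_le (x := x) (y := y) i j
  have hlt := cell_lt (n := n) (m := m) (i := i) (j := j) (f := 3) (by omega) (by omega)
    (by omega)
  have hc3 : cell n i j 0 + 3 = cell n i j 3 := rfl
  simp only [matching, loadField, Wp.seq_iff, Wp.assign_iff, Wp.load_iff, Expr.value,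
    State.setReg_reg, State.setReg_mem, h15, h12, h13, hc.r5, hc.r6, hc.r7, hc3, hL,
    Nat.reduceEqDiff, if_true, if_false]
  refine ⟨by omega, by omega, by omega, by omega, by omega, by omega, by omega, by omega, ?_⟩
  -- A round takes `24` steps and its test one. Starting from `matchLen x y i j + 2`, the number of
  -- rounds is the slack plus one, which yields the factor `25`.
  refine (Wp.while_potential (ShrinkInv ox oy x y i j σ) (fun τ => if τ.reg 32 = 0 then
      25 * (τ.reg 18 - matchLen x y (i + 1) (j + 1)) else 0) (fun _ _ => Test.eq_legal_iff.2 trivial) ?_ ?_).mono ?_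
  · intro τ hτ hb
    have h0 : τ.reg 32 = 0 := by
      rw [Test.eq_holds_iff, hτ.same 10 (by decide), hc.r10] at hb
      exact hb
    refine (wp_shrinkRound hs hi hj hc h14 hm hτ h0).mono ?_
    rintro t υ ⟨hυ, h18, ht⟩
    refine ⟨hυ, ?_⟩
    rw [if_pos h0]
    have := hυ.flag
    have := hτ.flag
    split_ifs <;> omega
  · refine ⟨?_, rfl, by simp, by simp, Or.inl ⟨by simp, by simp; omega, by simp⟩⟩
    repeat' apply SameBelow.setReg
    all_goals first | exact SameBelow.refl _ _ | decide
  · rintro t τ ⟨hτ, hb, ht⟩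
    rw [Test.eq_holds_iff, hτ.same 10 (by decide), hc.r10] at hb
    simp at ht
    have := hτ.flag
    exact ⟨by omega, hτ.same, hτ.mem, by omega⟩

end Matching

/-! ### The program: the window maxima -/

section Queue

variable {α : Type u} [LinearOrder α] {inp : List α} {S W k m n ox oy : ℕ} {x y : ℕ → α}

/-- Enter the best value of the front part of the queue at the next earlier cell. -/
def rebuildRound : Program :=
  loadField 27 30 2 ;; .assign 27 (.add 27 3) ;; .assign 27 (.add 27 29) ;;
  .assign 27 (.sub 27 17) ;; .ite (.lt 28 27) (.assign 28 (.reg 27)) .skip ;;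
  storeField 30 6 28 ;; .assign 30 (.sub 30 9) ;; .assign 29 (.add 29 7)

/-- Move the whole window into the front part of the queue. -/
def rebuild : Program :=
  .assign 28 (.const 0) ;; .assign 29 (.reg 2) ;; .assign 33 (.add 18 7) ;;
  .while (.lt 29 33) rebuildRound ;; .assign 19 (.const 0) ;; .assign 20 (.const 0)

/-- Move the window of the diagonal to the current cell, and compute the best value of a chain
that ends with a match at this cell. -/
def queue : Program :=
  .ite (.lt 18 2)
    (.assign 19 (.const 0) ;; .assign 20 (.const 0) ;; .assign 31 (.const 0))
    (loadField 19 15 4 ;; loadField 20 15 5 ;; .assign 19 (.add 19 7) ;;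
      .assign 30 (.mul 2 9) ;; .assign 30 (.sub 16 30) ;; loadField 27 30 2 ;;
      .assign 27 (.add 27 3) ;; .assign 27 (.add 27 2) ;; .assign 27 (.sub 27 17) ;;
      .ite (.lt 20 27) (.assign 20 (.reg 27)) .skip ;; .assign 28 (.add 19 2) ;;
      .ite (.lt 18 28) rebuild .skip ;;
      .assign 30 (.mul 18 9) ;; .assign 30 (.sub 16 30) ;; loadField 31 30 6 ;;
      .ite (.lt 31 20) (.assign 31 (.reg 20)) .skip ;;
      .assign 31 (.add 31 17) ;; .assign 31 (.sub 31 3))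

/-- The memory `mem'` arises from `mem` by changes of the front values at the cells of the
diagonal of `(i, j)` at distances from `k` to `l`. -/
def FrontChange (k n i j l : ℕ) (mem mem' : ℕ → ℕ) : Prop :=
  ∀ a, (∀ q, k ≤ q → q ≤ l → a ≠ cell n (i - q) (j - q) 6) → mem' a = mem a

variable (x y k m n) in
/-- The front values of the diagonal of `(i, j)` are right for the distances from `k + b` to `l`. -/
def FrontOK (b i j l : ℕ) (mem : ℕ → ℕ) : Prop :=
  ∀ q, k + b ≤ q → q ≤ l → mem (cell n (i - q) (j - q) 6) =
    (Finset.Ico (k + b) (q + 1)).sup (lastValue x y k m i j)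

variable (x y k m n) in
/-- The invariant of the loop that fills the front part of the queue. -/
structure RebuildInv (i j : ℕ) (σ₀ : State) (q : ℕ) (σ : State) : Prop where
  same : SameBelow 26 σ₀ σ
  r28 : σ.reg 28 = (Finset.Ico k q).sup (lastValue x y k m i j)
  r29 : σ.reg 29 = q
  r30 : σ.reg 30 = cell n i j 0 - q * (8 * (n + 2))
  r33 : σ.reg 33 = matchLen x y i j + 1
  change : FrontChange k n i j (q - 1) σ₀.mem σ.mem
  front : ∀ q', k ≤ q' → q' < q → σ.mem (cell n (i - q') (j - q') 6) =
    (Finset.Ico k (q' + 1)).sup (lastValue x y k m i j)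
  le : k ≤ q

theorem sup_lastValue_le {i j q : ℕ} (hi : i ≤ m) (hq : q ≤ i + 1) :
    (Finset.Ico k q).sup (lastValue x y k m i j) ≤ m :=
  Finset.sup_le fun p hp => lastValue_le hi (by rw [Finset.mem_Ico] at hp; omega)

theorem sup_Ico_succ {a b : ℕ} (h : a ≤ b) (f : ℕ → ℕ) :
    (Finset.Ico a (b + 1)).sup f = max ((Finset.Ico a b).sup f) (f b) := by
  rw [← Finset.insert_Ico_right_eq_Ico_add_one h, Finset.sup_insert, sup_comm]

theorem wp_rebuildRound (hs : Setting inp S W k m n ox oy x y) {i j q : ℕ} {σ₀ σ : State}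
    (hi : i ≤ m) (hj : j ≤ n) (hc : Consts k m n ox oy σ₀) (h17 : σ₀.reg 17 = i)
    (hC : ∀ q, k ≤ q → q ≤ matchLen x y i j →
      σ₀.mem (cell n (i - q) (j - q) 2) = optLen x y k (i - q) (j - q))
    (hq : q < matchLen x y i j + 1) (h : RebuildInv k m n x y i j σ₀ q σ) :
    Wp inp S W rebuildRound σ fun t τ =>
      RebuildInv k m n x y i j σ₀ (q + 1) τ ∧ t + 1 ≤ 14 := by
  have hword := hs.word
  have hsp := hs.space
  have hk := h.le
  have hpos := hs.pos
  obtain ⟨hL₁, hL₂, -⟩ := matchLen_spec (x := x) (y := y) i j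
  have hdiag := cell_diag n 0 (i := i) (j := j) (q := q) (by omega) (by omega)
  have h30 : σ.reg 30 = cell n (i - q) (j - q) 0 := by rw [h.r30]; omega
  have hlt := cell_lt (n := n) (m := m) (i := i - q) (j := j - q) (f := 7) (by omega) (by omega)
    (by omega)
  have c2 : cell n (i - q) (j - q) 0 + 2 = cell n (i - q) (j - q) 2 := rfl
  have c6 : cell n (i - q) (j - q) 0 + 6 = cell n (i - q) (j - q) 6 := rfl
  have c7 : cell n (i - q) (j - q) 0 + 7 = cell n (i - q) (j - q) 7 := rfl
  -- The loop writes only field `6`, so the optima in field `2` are still intact.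
  have hread : σ.mem (cell n (i - q) (j - q) 2) = optLen x y k (i - q) (j - q) := by
    rw [h.change, hC q hk (by omega)]
    intro q' _ _ he
    simp only [cell] at he
    omega
  have hopt := optLen_le (x := x) (y := y) (k := k) (i - q) (j - q)
  have hV : optLen x y k (i - q) (j - q) + m + q - i = lastValue x y k m i j q := rfl
  have hVle := lastValue_le (x := x) (y := y) (k := k) (j := j) hi (q := q) (by omega)
  have hsup := sup_lastValue_le (x := x) (y := y) (k := k) (j := j) hi (q := q) (by omega)
  have hsucc := sup_Ico_succ hk (lastValue x y k m i j)
  simp only [rebuildRound, loadField, storeField, Wp.seq_iff, Wp.assign_iff, Wp.load_iff,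
    Wp.store_iff, Wp.ite_iff, Wp.skip_iff, Test.lt_legal_iff, Test.lt_holds_iff, Expr.value,
    State.setReg_reg, State.setReg_mem, State.setMem_reg, h30, h.r28, h.r29,
    h.same 3 (by decide), h.same 17 (by decide), h.same 9 (by decide), h.same 7 (by decide),
    hc.r3, hc.r9, hc.r7, h17, c2, c6, hread, hV, Nat.reduceEqDiff, if_true, if_false]
  have hfront : ∀ (v : ℕ) (σ' : State), v = (Finset.Ico k (q + 1)).sup (lastValue x y k m i j) →
      (∀ a, σ'.mem a = if a = cell n (i - q) (j - q) 6 then v else σ.mem a) →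
      FrontChange k n i j (q + 1 - 1) σ₀.mem σ'.mem ∧ ∀ q', k ≤ q' → q' < q + 1 →
        σ'.mem (cell n (i - q') (j - q') 6) =
          (Finset.Ico k (q' + 1)).sup (lastValue x y k m i j) := by
    rintro v σ' rfl hm
    refine ⟨fun a ha => ?_, fun q' h₁ h₂ => ?_⟩
    · rw [hm, if_neg (ha q hk (by omega))]
      exact h.change a fun q' h₁ h₂ => ha q' h₁ (by omega)
    · rw [hm]
      by_cases h' : q' = q
      · rw [h', if_pos rfl]
      · rw [if_neg, h.front q' h₁ (by omega)]
        rw [cell_inj (by omega) (by omega) (by omega) (by omega)]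
        omega
  -- After the last round the address may truncate to `0`; both sides do so alike, and it is not
  -- used again.
  have hnext : cell n (i - q) (j - q) 0 - 8 * (n + 2) =
      cell n i j 0 - (q + 1) * (8 * (n + 2)) := by
    rw [Nat.succ_mul q]
    omega
  refine ⟨by omega, by omega, by omega, by omega, by omega, by omega, trivial,
    fun hlt => ⟨by omega, by omega, by omega, by omega, by omega, by omega, ?_, by omega⟩,
    fun hge => ⟨by omega, by omega, by omega, by omega, by omega, ?_, by omega⟩⟩
  · obtain ⟨f₁, f₂⟩ := hfront _ _ (by rw [hsucc, max_eq_right hlt.le]) (State.setMem_mem _ _ _)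
    refine ⟨?_, ?_, by simp, by simpa using hnext, by simpa using h.r33, f₁, f₂, by omega⟩
    · refine SameBelow.setReg (SameBelow.setReg (SameBelow.setMem ?_) (by decide)) (by decide)
      repeat' apply SameBelow.setReg
      all_goals first | exact h.same | decide
    · simp [hsucc, hlt.le]
  · obtain ⟨f₁, f₂⟩ := hfront _ _ (by rw [hsucc, max_eq_left (not_lt.1 hge)])
      (State.setMem_mem _ _ _)
    refine ⟨?_, ?_, by simp, by simpa using hnext, by simpa using h.r33, f₁, f₂, by omega⟩
    · refine SameBelow.setReg (SameBelow.setReg (SameBelow.setMem ?_) (by decide)) (by decide)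
      repeat' apply SameBelow.setReg
      all_goals first | exact h.same | decide
    · simp [hsucc, not_lt.1 hge, h.r28]

/-- The entries are visited from `q = k` outwards, so the running maximum at `q` is that of the
entries at least as new as `q`. When older entries expire, the maximum of the remaining ones is
therefore already stored at the oldest survivor. -/
theorem wp_rebuild (hs : Setting inp S W k m n ox oy x y) {i j : ℕ} {σ : State}
    (hi : i ≤ m) (hj : j ≤ n) (hc : Consts k m n ox oy σ) (h17 : σ.reg 17 = i)
    (h18 : σ.reg 18 = matchLen x y i j) (h30 : σ.reg 30 = cell n i j 0 - k * (8 * (n + 2)))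
    (hC : ∀ q, k ≤ q → q ≤ matchLen x y i j →
      σ.mem (cell n (i - q) (j - q) 2) = optLen x y k (i - q) (j - q))
    (hk : k ≤ matchLen x y i j) :
    Wp inp S W rebuild σ fun t τ => t ≤ 14 * (matchLen x y i j + 1 - k) + 6 ∧
      SameBelow 19 σ τ ∧ τ.reg 19 = 0 ∧ τ.reg 20 = 0 ∧
      FrontChange k n i j (matchLen x y i j) σ.mem τ.mem ∧
      FrontOK k m n x y 0 i j (matchLen x y i j) τ.mem := by
  have hword := hs.word
  obtain ⟨hL₁, hL₂, -⟩ := matchLen_spec (x := x) (y := y) i j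
  simp only [rebuild, Wp.seq_iff, Wp.assign_iff, Expr.value, State.setReg_reg, hc.r2, hc.r7, h18,
    Nat.reduceEqDiff, if_true, if_false]
  refine ⟨by omega, by omega, by omega, ?_⟩
  set σ₀ := ((σ.setReg 28 0).setReg 29 k).setReg 33 (matchLen x y i j + 1) with hσ₀
  have hsame : SameBelow 26 σ σ₀ :=
    (((SameBelow.refl _ _).setReg (by decide)).setReg (by decide)).setReg (by decide)
  refine (Wp.while_lt (RebuildInv k m n x y i j σ₀) (fun _ => 14) (N := matchLen x y i j + 1)
    (fun q τ h => ⟨h.r29, h.r33⟩)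
    (fun q τ hq h => wp_rebuildRound hs hi hj (hc.of_sameBelow (by decide) hsame)
      (by rw [hsame _ (by decide), h17]) hC hq h) (i := k) (by omega) ?_).mono ?_
  · exact ⟨SameBelow.refl _ _, by simp [hσ₀], by simp [hσ₀], by simpa [hσ₀] using h30,
      by simp [hσ₀], fun _ _ => rfl, fun _ _ _ => by omega, le_rfl⟩
  · rintro t τ ⟨h, ht⟩
    simp only [Finset.sum_const, Nat.card_Ico, smul_eq_mul] at ht
    refine ⟨by omega, by omega, by omega, ?_, by simp, by simp, h.change,
      fun q h₁ h₂ => h.front q h₁ (by omega)⟩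
    exact ((hsame.trans h.same).mono (by decide)).setReg (by decide) |>.setReg (by decide)

theorem backLen_eq_zero {i j : ℕ} (h : matchLen x y i j < k) : backLen x y k i j = 0 := by
  cases i with
  | zero => exact backLen_zero_left j
  | succ i =>
    cases j with
    | zero => exact backLen_zero_right _
    | succ j => rw [backLen_succ, if_pos (by omega)]

/-- After a diagonal step the old back part occupies the lengths from `k + 1` on with unchanged
values, and the only new entry is the one of length `k`. -/
theorem backMax_push (i j : ℕ) :
    max (backMax x y k m i j) (lastValue x y k m (i + 1) (j + 1) k) =
      (Finset.Ico k (k + (backLen x y k i j + 1))).sup (lastValue x y k m (i + 1) (j + 1)) := by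
  rw [backMax, ← sup_lastValue_succ, ← Finset.insert_Ico_add_one_left_eq_Ico
    (a := k) (b := k + (backLen x y k i j + 1)) (by omega), Finset.sup_insert, sup_comm]
  rfl

variable (x y k m) in
/-- The best value of a chain that ends with a match at the cell `(i, j)`. -/
noncomputable def bestEnd (i j : ℕ) : ℕ :=
  (Finset.Ico k (matchLen x y i j + 1)).sup (lastValue x y k m i j) + i - m

/-- Rebuilding happens only when `matchLen` at the new cell is less than `backLen x y k i j + 1 +
k`. The window then has at most `backLen x y k i j + 1` entries, and the fall of `backLen` to `0`
pays for moving them. -/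
theorem wp_queue (hs : Setting inp S W k m n ox oy x y) {i j : ℕ} {σ : State}
    (hi : i < m) (hj : j < n) (hc : Consts k m n ox oy σ)
    (h15 : σ.reg 15 = cell n i j 0) (h16 : σ.reg 16 = cell n (i + 1) (j + 1) 0)
    (h17 : σ.reg 17 = i + 1) (h18 : σ.reg 18 = matchLen x y (i + 1) (j + 1))
    (hC : ∀ q, k ≤ q → q ≤ matchLen x y (i + 1) (j + 1) →
      σ.mem (cell n (i + 1 - q) (j + 1 - q) 2) = optLen x y k (i + 1 - q) (j + 1 - q))
    (hb : σ.mem (cell n i j 4) = backLen x y k i j)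
    (hbm : σ.mem (cell n i j 5) = backMax x y k m i j)
    (hf : FrontOK k m n x y (backLen x y k i j) i j (matchLen x y i j) σ.mem) :
    Wp inp S W queue σ fun t τ =>
      t ≤ 14 * (backLen x y k i j + 1 - backLen x y k (i + 1) (j + 1)) + 60 ∧
      SameBelow 19 σ τ ∧ τ.reg 19 = backLen x y k (i + 1) (j + 1) ∧
      τ.reg 20 = backMax x y k m (i + 1) (j + 1) ∧ τ.reg 31 = bestEnd k m x y (i + 1) (j + 1) ∧
      FrontChange k n (i + 1) (j + 1) (matchLen x y (i + 1) (j + 1)) σ.mem τ.mem ∧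
      FrontOK k m n x y (backLen x y k (i + 1) (j + 1)) (i + 1) (j + 1)
        (matchLen x y (i + 1) (j + 1)) τ.mem := by
  have hword := hs.word
  have hsp := hs.space
  have hpos := hs.pos
  obtain ⟨hL₁, hL₂, -⟩ := matchLen_spec (x := x) (y := y) (i + 1) (j + 1)
  have hLL := matchLen_succ_le (x := x) (y := y) i j
  rw [queue, Wp.ite_iff, Test.lt_holds_iff, h18, hc.r2]
  refine ⟨Test.lt_legal_iff.2 trivial, fun hlt => ?_, fun hge => ?_⟩
  · simp only [Wp.seq_iff, Wp.assign_iff, Expr.value]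
    -- No length reaches `k`: the window is empty, and the queue is reset.
    have hb' := backLen_eq_zero hlt
    refine ⟨by omega, by omega, by omega, by omega, ?_, ?_, ?_, ?_, fun _ _ => rfl, ?_⟩
    · exact (((SameBelow.refl _ _).setReg (by decide)).setReg (by decide)).setReg (by decide)
    · simp [hb']
    · simp [backMax, hb']
    · simp [bestEnd, show matchLen x y (i + 1) (j + 1) + 1 ≤ k by omega]
      omega
    · intro q h₁ h₂
      omega
  · have hk : k ≤ matchLen x y (i + 1) (j + 1) := not_lt.1 hge
    set l := matchLen x y (i + 1) (j + 1) with hl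
    have d0 := cell_diag n 0 (i := i + 1) (j := j + 1) (q := k) (by omega) (by omega)
    have dl := cell_diag n 0 (i := i + 1) (j := j + 1) (q := l) (by omega) (by omega)
    have hlt := cell_lt (n := n) (m := m) (i := i) (j := j) (f := 7) (by omega) (by omega)
      (by omega)
    have hlt' := cell_lt (n := n) (m := m) (i := i + 1) (j := j + 1) (f := 7) (by omega) (by omega)
      (by omega)
    have hltk := cell_lt (n := n) (m := m) (i := i + 1 - k) (j := j + 1 - k) (f := 7) (by omega)
      (by omega) (by omega)
    have hltl := cell_lt (n := n) (m := m) (i := i + 1 - l) (j := j + 1 - l) (f := 7) (by omega)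
      (by omega) (by omega)
    have c4 : cell n i j 0 + 4 = cell n i j 4 := rfl
    have c5 : cell n i j 0 + 5 = cell n i j 5 := rfl
    have c7 : cell n i j 0 + 7 = cell n i j 7 := rfl
    have c7' : cell n (i + 1) (j + 1) 0 + 7 = cell n (i + 1) (j + 1) 7 := rfl
    have c2k : cell n (i + 1 - k) (j + 1 - k) 0 + 2 = cell n (i + 1 - k) (j + 1 - k) 2 := rfl
    have c7k : cell n (i + 1 - k) (j + 1 - k) 0 + 7 = cell n (i + 1 - k) (j + 1 - k) 7 := rfl
    have c6l : cell n (i + 1 - l) (j + 1 - l) 0 + 6 = cell n (i + 1 - l) (j + 1 - l) 6 := rfl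
    have c7l : cell n (i + 1 - l) (j + 1 - l) 0 + 7 = cell n (i + 1 - l) (j + 1 - l) 7 := rfl
    have ek : cell n (i + 1) (j + 1) 0 - k * (8 * (n + 2)) = cell n (i + 1 - k) (j + 1 - k) 0 := by
      omega
    have el : cell n (i + 1) (j + 1) 0 - l * (8 * (n + 2)) = cell n (i + 1 - l) (j + 1 - l) 0 := by
      omega
    have hopt := optLen_le (x := x) (y := y) (k := k) (i + 1 - k) (j + 1 - k)
    have hV : optLen x y k (i + 1 - k) (j + 1 - k) + m + k - (i + 1) =
      lastValue x y k m (i + 1) (j + 1) k := rfl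
    have hVle := lastValue_le (x := x) (y := y) (k := k) (j := j + 1) (i := i + 1) (m := m) hi
      (q := k) (by omega)
    have hpush := backMax_push (x := x) (y := y) (k := k) (m := m) i j
    have hblen := backLen_le (x := x) (y := y) (k := k) i j
    have hread := hC k le_rfl hk
    -- the state before the choice between the two ways to provide the front part
    have first : ∀ (p : Program) (Q : ℕ → State → Prop),
        (∀ t τ, t ≤ 19 → SameBelow 19 σ τ → τ.mem = σ.mem →
          τ.reg 19 = backLen x y k i j + 1 →
          τ.reg 20 = (Finset.Ico k (k + (backLen x y k i j + 1))).sup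
            (lastValue x y k m (i + 1) (j + 1)) →
          τ.reg 28 = backLen x y k i j + 1 + k →
          τ.reg 30 = cell n (i + 1 - k) (j + 1 - k) 0 →
          Wp inp S W p τ fun t' => Q (t + t')) →
        Wp inp S W (loadField 19 15 4 ;; loadField 20 15 5 ;; .assign 19 (.add 19 7) ;;
          .assign 30 (.mul 2 9) ;; .assign 30 (.sub 16 30) ;; loadField 27 30 2 ;;
          .assign 27 (.add 27 3) ;; .assign 27 (.add 27 2) ;; .assign 27 (.sub 27 17) ;;
          .ite (.lt 20 27) (.assign 20 (.reg 27)) .skip ;; .assign 28 (.add 19 2) ;; p) σ Q := by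
      intro p Q hQ
      simp only [loadField, Wp.seq_iff, Wp.assign_iff, Wp.load_iff,
        Wp.ite_iff, Wp.skip_iff, Test.lt_legal_iff, Test.lt_holds_iff, Expr.value,
        State.setReg_reg, State.setReg_mem, h15, h16, h17, hc.r2, hc.r3, hc.r7, hc.r9, c4, c5, hb,
        hbm, ek, c2k, hread, hV, Nat.reduceEqDiff, if_true, if_false]
      refine ⟨by omega, by omega, by omega, by omega, by omega, by omega, by omega, by omega,
        by omega, by omega, by omega, by omega, by omega, by omega, by omega, trivial,
        fun hlt => ⟨by omega, by omega, ?_⟩, fun hge => ⟨by omega, ?_⟩⟩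
      · simp only [← add_assoc]
        refine hQ _ _ (by omega) ?_ rfl (by simp) ?_ (by simp) (by simp)
        · repeat' apply SameBelow.setReg
          all_goals first | exact SameBelow.refl _ _ | decide
        · rw [← hpush, max_eq_right hlt.le]
          simp
      · simp only [← add_assoc]
        refine hQ _ _ (by omega) ?_ rfl (by simp) ?_ (by simp) (by simp)
        · repeat' apply SameBelow.setReg
          all_goals first | exact SameBelow.refl _ _ | decide
        · rw [← hpush, max_eq_left (not_lt.1 hge)]
          simp
    -- the final query
    have last : ∀ (τ : State) (b : ℕ), SameBelow 19 σ τ → k + b ≤ l → τ.reg 19 = b →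
        τ.reg 20 = (Finset.Ico k (k + b)).sup (lastValue x y k m (i + 1) (j + 1)) →
        FrontOK k m n x y b (i + 1) (j + 1) l τ.mem →
        Wp inp S W (.assign 30 (.mul 18 9) ;; .assign 30 (.sub 16 30) ;; loadField 31 30 6 ;;
          .ite (.lt 31 20) (.assign 31 (.reg 20)) .skip ;;
          .assign 31 (.add 31 17) ;; .assign 31 (.sub 31 3)) τ fun t υ => t ≤ 12 ∧
          SameBelow 19 σ υ ∧ υ.reg 19 = b ∧ υ.reg 20 = τ.reg 20 ∧
          υ.reg 31 = bestEnd k m x y (i + 1) (j + 1) ∧ υ.mem = τ.mem := by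
      intro τ b hsame hb r19 r20 hF
      have hF' := hF l hb le_rfl
      -- The window splits at `k + b` into the back part and the front part. The front maximum is
      -- read at the oldest entry, at distance `l`.
      have hsup : (Finset.Ico k (l + 1)).sup (lastValue x y k m (i + 1) (j + 1)) =
          max ((Finset.Ico (k + b) (l + 1)).sup (lastValue x y k m (i + 1) (j + 1)))
            ((Finset.Ico k (k + b)).sup (lastValue x y k m (i + 1) (j + 1))) := by
        rw [← Finset.Ico_union_Ico_eq_Ico (b := k + b) (by omega) (by omega : k + b ≤ l + 1),
          Finset.sup_union, sup_comm]
      have hle := sup_lastValue_le (x := x) (y := y) (k := k) (j := j + 1) (i := i + 1) (m := m) hi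
        (q := l + 1) (by omega)
      have hbest : (Finset.Ico k (l + 1)).sup (lastValue x y k m (i + 1) (j + 1)) + (i + 1) - m =
        bestEnd k m x y (i + 1) (j + 1) := rfl
      -- With the three maxima abstracted, only linear arithmetic remains.
      generalize (Finset.Ico (k + b) (l + 1)).sup (lastValue x y k m (i + 1) (j + 1)) = A at *
      generalize (Finset.Ico k (k + b)).sup (lastValue x y k m (i + 1) (j + 1)) = B at *
      generalize (Finset.Ico k (l + 1)).sup (lastValue x y k m (i + 1) (j + 1)) = C at *
      simp only [loadField, Wp.seq_iff, Wp.assign_iff, Wp.load_iff,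
        Wp.ite_iff, Wp.skip_iff, Test.lt_legal_iff, Test.lt_holds_iff, Expr.value,
        State.setReg_reg, State.setReg_mem, hsame 18 (by decide), hsame 9 (by decide),
        hsame 16 (by decide), hsame 17 (by decide), hsame 3 (by decide), h16, h17, h18, hc.r9,
        hc.r3, el, c6l, hF', r20, Nat.reduceEqDiff, if_true, if_false]
      refine ⟨by omega, by omega, by omega, by omega, by omega, trivial,
        fun hlt => ⟨by omega, by omega, by omega, by omega, ?_, by simpa using r19,
          by simp, ?_, trivial⟩,
        fun hge => ⟨by omega, by omega, by omega, ?_, by simpa using r19,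
          by simp, ?_, trivial⟩⟩
      · repeat' apply SameBelow.setReg
        all_goals first | exact hsame | decide
      · rw [max_eq_right hlt.le] at hsup
        omega
      · repeat' apply SameBelow.setReg
        all_goals first | exact hsame | decide
      · rw [max_eq_left (not_lt.1 hge)] at hsup
        omega
    apply first
    intro t₁ τ₁ ht₁ s₁ m₁ r19 r20 r28 r30
    rw [Wp.seq_iff, Wp.ite_iff, Test.lt_holds_iff, s₁ 18 (by decide), h18, r28]
    have hB := backLen_succ (x := x) (y := y) (k := k) i j
    rw [← hl] at hB
    refine ⟨Test.lt_legal_iff.2 trivial, fun hr => ?_, fun hr => ?_⟩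
    · rw [if_pos hr] at hB
      rw [hB]
      refine (wp_rebuild hs (i := i + 1) (j := j + 1) (by omega) (by omega)
        (hc.of_sameBelow (by decide) s₁) (by rw [s₁ _ (by decide), h17])
        (by rw [s₁ _ (by decide), h18]) (by rw [r30, ek]) (by rwa [m₁]) hk).mono ?_
      rintro t₂ τ₂ ⟨ht₂, s₂, q19, q20, hch, hF⟩
      refine (last τ₂ 0 (s₁.trans s₂) hk q19 (by simp [q20]) hF).mono ?_
      rintro t₃ τ₃ ⟨ht₃, s₃, p19, p20, p31, m₃⟩
      refine ⟨by omega, s₃, p19, ?_, p31, ?_, ?_⟩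
      · rw [p20, q20, backMax, hB]
        simp
      · rwa [m₃, ← m₁]
      · rwa [m₃]
    · rw [if_neg hr] at hB
      rw [hB, Wp.skip_iff]
      -- The front part stays in the same physical cells: distances and the boundary of the back
      -- part all grow by one. The bound on the growth of `matchLen` keeps the shifted distances
      -- within the old range.
      have hF : FrontOK k m n x y (backLen x y k i j + 1) (i + 1) (j + 1) l τ₁.mem := by
        intro q h₁ h₂
        obtain ⟨q, rfl⟩ : ∃ q', q = q' + 1 := ⟨q - 1, by omega⟩
        rw [m₁, Nat.add_sub_add_right, Nat.add_sub_add_right, hf q (by omega) (by omega),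
          ← add_assoc, sup_lastValue_succ]
      refine (last τ₁ _ s₁ (by omega) r19 r20 hF).mono ?_
      rintro t₃ τ₃ ⟨ht₃, s₃, p19, p20, p31, m₃⟩
      refine ⟨by omega, s₃, p19, ?_, p31, ?_, ?_⟩
      · rw [p20, r20, backMax, hB]
      · rw [m₃, m₁]
        exact fun _ _ => rfl
      · rwa [m₃]

end Queue

/-! ### The program: filling the table -/

section Fill

variable {α : Type u} [LinearOrder α] {inp : List α} {S W k m n ox oy : ℕ} {x y : ℕ → α}

/-- Raise register `31` to the optimum stored in the record whose address is in register `30`. -/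
def maxField : Program :=
  loadField 27 30 2 ;; .ite (.lt 31 27) (.assign 31 (.reg 27)) .skip

/-- Store the record of a cell, and go to the next cell of the row. -/
def storeRecord : Program :=
  storeField 16 2 31 ;; storeField 16 3 18 ;; storeField 16 4 19 ;; storeField 16 5 20 ;;
  .assign 13 (.add 13 7) ;; .assign 15 (.add 15 11)

/-- Compute the record of a cell from those of its neighbours. -/
def cellBody : Program :=
  .assign 16 (.add 15 9) ;; .assign 17 (.add 12 7) ;; matching ;; queue ;;
  .assign 30 (.add 15 11) ;; maxField ;; .assign 30 (.sub 16 11) ;; maxField ;; storeRecord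

/-- Compute the records of a row. -/
def rowBody : Program :=
  .assign 13 (.const 0) ;; .assign 14 (.mul 12 8) ;; .assign 14 (.mul 14 11) ;;
  .assign 15 (.reg 14) ;; .while (.lt 13 4) cellBody ;; .assign 12 (.add 12 7)

/-- Compute all records. -/
def fill : Program := .assign 12 (.const 0) ;; .while (.lt 12 3) rowBody

/-- Solve the problem for a string that is not longer than the other one. -/
def solve : Program :=
  table ;; fill ;; .assign 15 (.mul 3 8) ;; .assign 15 (.add 15 4) ;; .assign 15 (.mul 15 11) ;;
  loadField 0 15 2

variable (k m n x y) in
/-- The memory after the rows up to `i`, and the next one up to column `j`, have been computed. -/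
structure MemInv (i j : ℕ) (mem : ℕ → ℕ) : Prop where
  near : ∀ e l, e < m → l ≤ e →
    mem (cell n e l 0) = below x e l ∧ mem (cell n e l 1) = above x e l
  entry : ∀ i' j', i' ≤ m → j' ≤ n → (i' ≤ i ∨ (i' = i + 1 ∧ j' ≤ j) ∨ j' = 0) →
    mem (cell n i' j' 2) = optLen x y k i' j' ∧ mem (cell n i' j' 3) = matchLen x y i' j' ∧
    mem (cell n i' j' 4) = backLen x y k i' j' ∧ mem (cell n i' j' 5) = backMax x y k m i' j'
  front : ∀ i' j', j' ≤ n → ((i' = i ∧ j ≤ j') ∨ (i' = i + 1 ∧ j' ≤ j)) →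
    FrontOK k m n x y (backLen x y k i' j') i' j' (matchLen x y i' j') mem

/-- The all-zero fields are correct on both borders, and the front conditions there are vacuous
since `k ≥ 1` while `matchLen` vanishes. -/
theorem TableInv.memInv (hk : 1 ≤ k) {mem : ℕ → ℕ} (h : TableInv m n x m 0 mem) :
    MemInv k m n x y 0 0 mem := by
  refine ⟨fun e l he hl => h.near e l he hl (Or.inl he), fun i j _ _ hij => ?_,
    fun i j _ hij q h₁ h₂ => ?_⟩
  · simp only [h.rest i j _ (show 2 ≤ 2 by omega) (by omega),
      h.rest i j _ (show 2 ≤ 3 by omega) (by omega), h.rest i j _ (show 2 ≤ 4 by omega) (by omega),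
      h.rest i j _ (show 2 ≤ 5 by omega) (by omega)]
    obtain rfl | rfl : i = 0 ∨ j = 0 := by omega
    · simp [optLen_zero_left, matchLen_zero_left, backLen_zero_left, backMax]
    · simp [optLen_zero_right, matchLen_zero_right, backLen_zero_right, backMax]
  · have : matchLen x y i j = 0 := by
      obtain rfl | rfl : i = 0 ∨ j = 0 := by omega
      · exact matchLen_zero_left j
      · exact matchLen_zero_right i
    omega

theorem MemInv.next_row (hk : 1 ≤ k) {i : ℕ} {mem : ℕ → ℕ} (h : MemInv k m n x y i n mem) :
    MemInv k m n x y (i + 1) 0 mem := by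
  refine ⟨h.near, fun i' j' hi' hj' hij => h.entry i' j' hi' hj' (by omega),
    fun i' j' hj' hij => ?_⟩
  rcases hij with hij | ⟨rfl, h0⟩
  · exact h.front i' j' hj' (Or.inr ⟨hij.1, hj'⟩)
  · obtain rfl : j' = 0 := by omega
    intro q h₁ h₂
    rw [matchLen_zero_right] at h₂
    omega

/-- Front values are required only on the current frontier, which consists of the computed part of
the new row and the rest of the old one. On the diagonal being advanced, the old frontier cell `(i,
j)` is replaced by `(i + 1, j + 1)`, so overwriting its front part harms nothing. -/
theorem MemInv.step (hmn : m ≤ n) {i j : ℕ} {mem mem₁ mem₂ : ℕ → ℕ}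
    (h : MemInv k m n x y i j mem) (hj : j < n)
    (hch : FrontChange k n (i + 1) (j + 1) (matchLen x y (i + 1) (j + 1)) mem mem₁)
    (hF : FrontOK k m n x y (backLen x y k (i + 1) (j + 1)) (i + 1) (j + 1)
      (matchLen x y (i + 1) (j + 1)) mem₁)
    (hm : ∀ a, mem₂ a =
      if a = cell n (i + 1) (j + 1) 5 then backMax x y k m (i + 1) (j + 1)
      else if a = cell n (i + 1) (j + 1) 4 then backLen x y k (i + 1) (j + 1)
      else if a = cell n (i + 1) (j + 1) 3 then matchLen x y (i + 1) (j + 1)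
      else if a = cell n (i + 1) (j + 1) 2 then optLen x y k (i + 1) (j + 1)
      else mem₁ a) :
    MemInv k m n x y i (j + 1) mem₂ := by
  obtain ⟨hL₁, hL₂, -⟩ := matchLen_spec (x := x) (y := y) (i + 1) (j + 1)
  -- the fields other than the front values change at one cell only
  have keep₁ : ∀ i' j' f, f < 6 → mem₁ (cell n i' j' f) = mem (cell n i' j' f) := by
    intro i' j' f hf
    refine hch _ fun q _ _ he => ?_
    simp only [cell] at he
    omega
  have keep : ∀ i' j' f, j' ≤ n → f < 8 → (f < 2 ∨ 6 ≤ f ∨ ¬ (i' = i + 1 ∧ j' = j + 1)) →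
      mem₂ (cell n i' j' f) = mem₁ (cell n i' j' f) := by
    intro i' j' f hj' hf hc
    rw [hm, if_neg, if_neg, if_neg, if_neg] <;>
    · rw [cell_inj hj' (by omega) hf (by omega)]
      omega
  constructor
  · intro e l he hl
    rw [keep _ _ _ (by omega) (by omega) (by omega), keep _ _ _ (by omega) (by omega) (by omega),
      keep₁ _ _ _ (by omega), keep₁ _ _ _ (by omega)]
    exact h.near e l he hl
  · intro i' j' hi' hj' hij
    by_cases hc : i' = i + 1 ∧ j' = j + 1
    · obtain ⟨rfl, rfl⟩ := hc
      simp [hm, cell]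
    · rw [keep _ _ _ hj' (by omega) (by omega), keep _ _ _ hj' (by omega) (by omega),
        keep _ _ _ hj' (by omega) (by omega), keep _ _ _ hj' (by omega) (by omega),
        keep₁ _ _ _ (by omega), keep₁ _ _ _ (by omega), keep₁ _ _ _ (by omega),
        keep₁ _ _ _ (by omega)]
      exact h.entry i' j' hi' hj' (by omega)
  · intro i' j' hj' hij q h₁ h₂
    rw [keep _ _ _ (by omega) (by omega) (by omega)]
    by_cases hc : i' = i + 1 ∧ j' = j + 1
    · obtain ⟨rfl, rfl⟩ := hc
      exact hF q h₁ h₂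
    -- Every other frontier cell lies on a different diagonal, and the changed front values all lie
    -- on that of `(i + 1, j + 1)`.
    · obtain ⟨hl₁, hl₂, -⟩ := matchLen_spec (x := x) (y := y) i' j'
      rw [hch, h.front i' j' hj' (by omega) q h₁ h₂]
      intro q' h₃ h₄ he
      rw [cell_inj (by omega) (by omega) (by omega) (by omega)] at he
      omega

omit [LinearOrder α] in
theorem wp_maxField [LE α] {σ : State} {a : ℕ} (h30 : σ.reg 30 = a) (hS : a + 2 < S)
    (hW : a + 2 < W) (hv : σ.mem (a + 2) < W) :
    Wp inp S W maxField σ fun t τ => t ≤ 5 ∧ SameBelow 26 σ τ ∧ τ.mem = σ.mem ∧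
      τ.reg 31 = max (σ.reg 31) (σ.mem (a + 2)) := by
  simp only [maxField, loadField, Wp.seq_iff, Wp.assign_iff, Wp.load_iff,
    Wp.ite_iff, Wp.skip_iff, Test.lt_legal_iff, Test.lt_holds_iff, Expr.value,
    State.setReg_reg, State.setReg_mem, h30, Nat.reduceEqDiff, if_true, if_false]
  refine ⟨by omega, by omega, by omega, trivial,
    fun hlt => ⟨by omega, by omega, ?_, trivial, by omega⟩,
    fun hge => ⟨by omega, ?_, trivial, by omega⟩⟩ <;>
  · repeat' apply SameBelow.setReg
    all_goals first | exact SameBelow.refl _ _ | decide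

variable (k m n ox oy x y) in
/-- The invariant of the loop over the cells of a row. -/
structure CellInv (i j : ℕ) (σ : State) : Prop where
  consts : Consts k m n ox oy σ
  r12 : σ.reg 12 = i
  r13 : σ.reg 13 = j
  r14 : σ.reg 14 = cell n i 0 0
  r15 : σ.reg 15 = cell n i j 0
  mem : MemInv k m n x y i j σ.mem

variable (k x y) in
/-- The cost of a cell. -/
noncomputable def cellCost (i j : ℕ) : ℕ :=
  25 * (matchLen x y i j + 1 - matchLen x y (i + 1) (j + 1)) +
    (14 * (backLen x y k i j + 1 - backLen x y k (i + 1) (j + 1)) + 130)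

theorem wp_storeRecord (hs : Setting inp S W k m n ox oy x y) {i j : ℕ} {σ τ : State}
    (hi : i < m) (hj : j < n) (h : CellInv k m n ox oy x y i j σ) (s : SameBelow 16 σ τ)
    (r16 : τ.reg 16 = cell n (i + 1) (j + 1) 0) (r18 : τ.reg 18 = matchLen x y (i + 1) (j + 1))
    (r19 : τ.reg 19 = backLen x y k (i + 1) (j + 1))
    (r20 : τ.reg 20 = backMax x y k m (i + 1) (j + 1))
    (r31 : τ.reg 31 = optLen x y k (i + 1) (j + 1))
    (hch : FrontChange k n (i + 1) (j + 1) (matchLen x y (i + 1) (j + 1)) σ.mem τ.mem)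
    (hF : FrontOK k m n x y (backLen x y k (i + 1) (j + 1)) (i + 1) (j + 1)
      (matchLen x y (i + 1) (j + 1)) τ.mem) :
    Wp inp S W storeRecord τ fun t υ => CellInv k m n ox oy x y i (j + 1) υ ∧ t ≤ 14 := by
  have hword := hs.word
  have hsp := hs.space
  have hc := h.consts
  have hlt := cell_lt (n := n) (m := m) (i := i) (j := j + 1) (f := 0) (by omega) (by omega)
    (by omega)
  have hlt₂ := cell_lt (n := n) (m := m) (i := i + 1) (j := j + 1) (f := 7) (by omega) (by omega)
    (by omega)
  have g : ∀ f, cell n (i + 1) (j + 1) 0 + f = cell n (i + 1) (j + 1) f := fun f => by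
    simp [cell]
  simp only [storeRecord, storeField, Wp.seq_iff, Wp.assign_iff, Wp.store_iff, Expr.value,
    State.setReg_reg, State.setMem_reg, s 13 (by decide), s 15 (by decide), s 7 (by decide),
    s 11 (by decide), hc.r7, hc.r11, h.r13, h.r15, r16, r18, r19, r20, r31, g,
    ← cell_succ_right, Nat.reduceEqDiff, if_true, if_false]
  have g2 := g 2
  have g3 := g 3
  have g4 := g 4
  have g5 := g 5
  have g7 := g 7
  have hle := hs.le
  refine ⟨by omega, by omega, by omega, by omega, by omega, by omega, by omega, by omega, by omega,
    by omega, by omega, by omega, by omega, by omega, ?_, by omega⟩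
  constructor
  · have hcτ := hc.of_sameBelow (by decide) s
    refine Consts.setReg (Consts.setReg (Consts.setMem ?_) (by decide)) (by decide)
    refine Consts.setReg (Consts.setReg (Consts.setMem ?_) (by decide)) (by decide)
    refine Consts.setReg (Consts.setReg (Consts.setMem ?_) (by decide)) (by decide)
    refine Consts.setReg (Consts.setReg (Consts.setMem ?_) (by decide)) (by decide)
    exact (hcτ.setReg (by decide)).setReg (by decide)
  · simpa using (s 12 (by decide)).trans h.r12
  · simp
  · simpa using (s 14 (by decide)).trans h.r14
  · simp
  · refine h.mem.step hle hj hch hF fun a => ?_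
    simp

theorem wp_cellBody (hs : Setting inp S W k m n ox oy x y) {i j : ℕ} {σ : State}
    (hi : i < m) (hj : j < n) (h : CellInv k m n ox oy x y i j σ) :
    Wp inp S W cellBody σ fun t τ => CellInv k m n ox oy x y i (j + 1) τ ∧
      t + 1 ≤ cellCost k x y i j := by
  have hword := hs.word
  have hsp := hs.space
  have hmn := hs.le
  have hpos := hs.pos
  have hc := h.consts
  obtain ⟨hL₁, hL₂, -⟩ := matchLen_spec (x := x) (y := y) (i + 1) (j + 1)
  have hlt := cell_lt (n := n) (m := m) (i := i) (j := j + 1) (f := 7) (by omega) (by omega)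
    (by omega)
  have hlt₁ := cell_lt (n := n) (m := m) (i := i + 1) (j := j) (f := 7) (by omega) (by omega)
    (by omega)
  have hlt₂ := cell_lt (n := n) (m := m) (i := i + 1) (j := j + 1) (f := 7) (by omega) (by omega)
    (by omega)
  have c7 : cell n i (j + 1) 0 + 7 = cell n i (j + 1) 7 := rfl
  have c7₁ : cell n (i + 1) j 0 + 7 = cell n (i + 1) j 7 := rfl
  have c7₂ : cell n (i + 1) (j + 1) 0 + 7 = cell n (i + 1) (j + 1) 7 := rfl
  have e15 := cell_succ_right n i j 0
  have e16 := cell_succ_right n (i + 1) j 0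
  have e16' : cell n i j 0 + 8 * (n + 2) = cell n (i + 1) (j + 1) 0 := by
    rw [e16, cell_succ_left]
    omega
  have e30 : cell n (i + 1) (j + 1) 0 - 8 = cell n (i + 1) j 0 := by omega
  have hent := h.mem.entry i j (by omega) (by omega) (Or.inl le_rfl)
  have ho₁ := optLen_le (x := x) (y := y) (k := k) i (j + 1)
  have ho₂ := optLen_le (x := x) (y := y) (k := k) (i + 1) j
  rw [cellBody]
  simp only [Wp.seq_iff (p := .assign _ _), Wp.assign_iff, Expr.value, State.setReg_reg, h.r15,
    h.r12, hc.r9, hc.r7, e16', Nat.reduceEqDiff, if_false]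
  refine ⟨by omega, by omega, ?_⟩
  set σ₀ := (σ.setReg 16 (cell n (i + 1) (j + 1) 0)).setReg 17 (i + 1) with hσ₀
  have s₀ : SameBelow 16 σ σ₀ :=
    ((SameBelow.refl _ _).setReg (by decide)).setReg (by decide)
  rw [Wp.seq_iff]
  refine (wp_matching hs hi hj (hc.of_sameBelow (by decide) s₀) (by rw [s₀ _ (by decide), h.r12])
    (by rw [s₀ _ (by decide), h.r13]) (by rw [s₀ _ (by decide), h.r14])
    (by rw [s₀ _ (by decide), h.r15]) (fun l hl => h.mem.near i l hi hl) hent.2.1).mono ?_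
  rintro t₁ σ₁ ⟨ht₁, s₁, m₁, r18⟩
  have m₁' : σ₁.mem = σ.mem := m₁
  have s01 : SameBelow 16 σ σ₁ := s₀.trans (s₁.mono (by decide))
  have r16 : σ₁.reg 16 = cell n (i + 1) (j + 1) 0 := by rw [s₁ _ (by decide)]; simp [hσ₀]
  have r17 : σ₁.reg 17 = i + 1 := by rw [s₁ _ (by decide)]; simp [hσ₀]
  rw [Wp.seq_iff]
  refine (wp_queue hs hi hj (hc.of_sameBelow (by decide) s01) (by rw [s01 _ (by decide), h.r15])
    r16 r17 r18 ?_ (by rw [m₁']; exact hent.2.2.1) (by rw [m₁']; exact hent.2.2.2)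
    (by rw [m₁']; exact h.mem.front i j (by omega) (Or.inl ⟨rfl, le_rfl⟩))).mono ?_
  -- Because `q ≥ k ≥ 1`, the optima read on the diagonal lie in completed rows.
  · intro q h₁ h₂
    rw [m₁']
    exact (h.mem.entry _ _ (by omega) (by omega) (Or.inl (by omega))).1
  rintro t₂ σ₂ ⟨ht₂, s₂, r19, r20, r31, hch, hF⟩
  have s02 : SameBelow 16 σ σ₂ := s01.trans (s₂.mono (by decide))
  have keep : ∀ i' j', σ₂.mem (cell n i' j' 2) = σ.mem (cell n i' j' 2) := by
    intro i' j'
    rw [hch, m₁']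
    intro q _ _ he
    simp only [cell] at he
    omega
  have f15 : σ₂.reg 15 = cell n i j 0 := by rw [s02 _ (by decide), h.r15]
  have f16 : σ₂.reg 16 = cell n (i + 1) (j + 1) 0 := by rw [s₂ _ (by decide), r16]
  have f11 : σ₂.reg 11 = 8 := by rw [s02 _ (by decide), hc.r11]
  have v₁ : σ₂.mem (cell n i (j + 1) 0 + 2) = optLen x y k i (j + 1) :=
    (keep i (j + 1)).trans (h.mem.entry _ _ (by omega) (by omega) (by omega)).1
  have v₂ : σ₂.mem (cell n (i + 1) j 0 + 2) = optLen x y k (i + 1) j :=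
    (keep (i + 1) j).trans (h.mem.entry _ _ (by omega) (by omega) (by omega)).1
  rw [Wp.seq_iff, Wp.assign_iff, Wp.seq_iff, Expr.value, f15, f11, ← e15]
  refine ⟨by omega, ?_⟩
  refine (wp_maxField (a := cell n i (j + 1) 0) (by simp) (by omega) (by omega)
    (by rw [State.setReg_mem, v₁]; omega)).mono ?_
  rintro t₃ σ₃ ⟨ht₃, s₃, m₃, q31⟩
  have s₃' : SameBelow 26 σ₂ σ₃ :=
    ((SameBelow.refl 26 σ₂).setReg (r := 30) (by decide)).trans s₃
  have m₃' : σ₃.mem = σ₂.mem := m₃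
  rw [Wp.seq_iff, Wp.assign_iff, Wp.seq_iff, Expr.value, s₃' 16 (by decide), s₃' 11 (by decide),
    f16, f11, e30]
  refine ⟨by omega, ?_⟩
  refine (wp_maxField (a := cell n (i + 1) j 0) (by simp) (by omega) (by omega)
    (by rw [State.setReg_mem, m₃', v₂]; omega)).mono ?_
  rintro t₄ σ₄ ⟨ht₄, s₄, m₄, p31⟩
  have s₄' : SameBelow 26 σ₂ σ₄ :=
    s₃'.trans (((SameBelow.refl 26 σ₃).setReg (r := 30) (by decide)).trans s₄)
  have m₄' : σ₄.mem = σ₂.mem := m₄.trans m₃'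
  -- The two calls of `maxField` add the neighbouring optima to `bestEnd`, in the order of the
  -- recurrence.
  have g31 : σ₄.reg 31 = optLen x y k (i + 1) (j + 1) := by
    rw [p31, State.setReg_mem, m₃', v₂]
    simp only [State.setReg_reg, Nat.reduceEqDiff, if_false]
    rw [q31, State.setReg_mem, v₁]
    simp only [State.setReg_reg, Nat.reduceEqDiff, if_false]
    rw [r31, bestEnd, ← optLen_succ j hi]
  have s04 : SameBelow 16 σ σ₄ := s02.trans (s₄'.mono (by decide))
  have hcost : cellCost k x y i j =
    25 * (matchLen x y i j + 1 - matchLen x y (i + 1) (j + 1)) +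
    (14 * (backLen x y k i j + 1 - backLen x y k (i + 1) (j + 1)) + 130) := rfl
  refine (wp_storeRecord hs hi hj h s04 (by rw [s₄' 16 (by decide), f16])
    (by rw [s₄' 18 (by decide), s₂ 18 (by decide), r18]) (by rw [s₄' 19 (by decide), r19])
    (by rw [s₄' 20 (by decide), r20]) g31 (by rw [m₄', ← m₁']; exact hch)
    (by rw [m₄']; exact hF)).mono ?_
  rintro t₅ σ₅ ⟨hinv, ht₅⟩
  exact ⟨hinv, by omega⟩

theorem wp_rowBody (hs : Setting inp S W k m n ox oy x y) {i : ℕ} {σ : State} (hi : i < m)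
    (hc : Consts k m n ox oy σ) (h12 : σ.reg 12 = i) (hm : MemInv k m n x y i 0 σ.mem) :
    Wp inp S W rowBody σ fun t τ => (Consts k m n ox oy τ ∧ τ.reg 12 = i + 1 ∧
      MemInv k m n x y (i + 1) 0 τ.mem) ∧
      t + 1 ≤ ∑ j ∈ Finset.range n, cellCost k x y i j + 10 := by
  have hword := hs.word
  have hcell : i * (n + 1) * 8 = cell n i 0 0 := by simp only [cell]; ring
  have hlt := cell_lt (n := n) (m := m) (i := i) (j := 0) (f := 0) (by omega) (by omega)
    (by omega)
  have hle : i * (n + 1) ≤ i * (n + 1) * 8 := by omega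
  simp only [rowBody, Wp.seq_iff, Wp.assign_iff, Expr.value, State.setReg_reg,
    h12, hc.r8, hc.r11, Nat.reduceEqDiff, if_true, if_false, hcell]
  refine ⟨by omega, by omega, by omega, by omega, ?_⟩
  refine (Wp.while_lt (CellInv k m n ox oy x y i) (cellCost k x y i) (N := n)
    (fun j τ h => ⟨h.r13, h.consts.r4⟩) (fun j τ hj h => wp_cellBody hs hi hj h) (Nat.zero_le n)
    ?_).mono ?_
  · constructor
    · repeat' apply Consts.setReg
      all_goals first | exact hc | decide
    · simpa using h12
    · simp
    · simp
    · simp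
    · exact hm
  · rintro t τ ⟨h, ht⟩
    rw [Nat.Ico_zero_eq_range] at ht
    simp only [h.r12, h.consts.r7]
    exact ⟨by omega, ⟨h.consts.setReg (by decide), by simp, h.mem.next_row hs.pos⟩, by omega⟩

/-- The slacks of `matchLen` and `backLen` each sum to at most `m * n`, and `25 + 14 + 130 = 169`.
-/
theorem sum_cellCost_le (m n : ℕ) :
    ∑ i ∈ Finset.range m, ∑ j ∈ Finset.range n, cellCost k x y i j ≤ 169 * (m * n) := by
  have h₁ := sum_slack_le matchLen_zero_left matchLen_zero_right
    (matchLen_succ_le (x := x) (y := y)) m n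
  have h₂ := sum_slack_le backLen_zero_left backLen_zero_right (f := backLen x y k)
    (fun i j => by rw [backLen_succ]; split_ifs <;> omega) m n
  simp only [cellCost, Finset.sum_add_distrib, ← Finset.mul_sum, Finset.sum_const,
    Finset.card_range, smul_eq_mul]
  have h₃ : n * (m * 130) = 130 * (m * n) := by ring
  omega

theorem wp_fill (hs : Setting inp S W k m n ox oy x y) {σ : State}
    (hc : Consts k m n ox oy σ) (hm : MemInv k m n x y 0 0 σ.mem) :
    Wp inp S W fill σ fun t τ => Consts k m n ox oy τ ∧ MemInv k m n x y m 0 τ.mem ∧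
      t ≤ 169 * (m * n) + 10 * m + 2 := by
  have hword := hs.word
  simp only [fill, Wp.seq_iff, Wp.assign_iff, Expr.value]
  refine ⟨by omega, ?_⟩
  refine (Wp.while_lt (fun i τ => Consts k m n ox oy τ ∧ τ.reg 12 = i ∧
    MemInv k m n x y i 0 τ.mem) (fun i => ∑ j ∈ Finset.range n, cellCost k x y i j + 10) (N := m)
    (fun i σ h => ⟨h.2.1, h.1.r3⟩) (fun i σ hi h => wp_rowBody hs hi h.1 h.2.1 h.2.2)
    (Nat.zero_le m) ⟨hc.setReg (by decide), by simp, hm⟩).mono ?_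
  rintro t τ ⟨h, ht⟩
  have := sum_cellCost_le (k := k) (x := x) (y := y) m n
  simp only [Finset.sum_add_distrib, Finset.sum_const, smul_eq_mul,
    Nat.Ico_zero_eq_range, Finset.card_range] at ht
  exact ⟨h.1, h.2.2, by omega⟩

theorem wp_solve (hs : Setting inp S W k m n ox oy x y) {σ : State}
    (hc : Consts k m n ox oy σ) (hm : ∀ a, σ.mem a = 0) :
    Wp inp S W solve σ fun t τ =>
      t ≤ m * (17 * m + 20) + 169 * (m * n) + 10 * m + 20 ∧ τ.reg 0 = optLen x y k m n := by
  have hword := hs.word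
  have hsp := hs.space
  have hlt := cell_lt (n := n) (m := m) (i := m) (j := n) (f := 2) le_rfl le_rfl (by omega)
  have hcell : (m * (n + 1) + n) * 8 = cell n m n 0 := by simp only [cell]; ring
  have c2 : cell n m n 0 + 2 = cell n m n 2 := rfl
  rw [solve, Wp.seq_iff]
  refine (wp_table hs hc hm).mono ?_
  rintro t₁ σ₁ ⟨hc₁, hm₁, ht₁⟩
  rw [Wp.seq_iff]
  refine (wp_fill hs hc₁ (hm₁.memInv hs.pos)).mono ?_
  rintro t₂ σ₂ ⟨hc₂, hm₂, ht₂⟩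
  simp only [loadField, Wp.seq_iff, Wp.assign_iff, Wp.load_iff, Expr.value, State.setReg_reg,
    State.setReg_mem, hc₂.r3, hc₂.r4, hc₂.r8, hc₂.r11, hcell, c2,
    (hm₂.entry m n le_rfl le_rfl (Or.inl le_rfl)).1, Nat.reduceEqDiff, if_true, if_false]
  refine ⟨by omega, by omega, by omega, by omega, by omega, by omega, by omega, trivial⟩

end Fill

/-! ### Chains of matches and common subsequences -/

section Strings

variable {α : Type u}

theorem length_substr {X : List α} {i l : ℕ} (h : i + l ≤ X.length) :
    (substr X i l).length = l := by
  simp only [substr, List.length_take, List.length_drop]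
  omega

theorem OrderIsomorphic.symm [LE α] {S T : List α} (h : OrderIsomorphic S T) :
    OrderIsomorphic T S := by
  obtain ⟨h, h'⟩ := h
  exact ⟨h.symm, fun a b ha hb => (h' a b (h ▸ ha) (h ▸ hb)).symm⟩

theorem substr_append_left {X Y : List α} {i l : ℕ} (h : i + l ≤ X.length) :
    substr (X ++ Y) i l = substr X i l := by
  rw [substr, substr, List.drop_append_of_le_length (by omega),
    List.take_append_of_le_length (by rw [List.length_drop]; omega)]

theorem substr_append_length (X Y : List α) : substr (X ++ Y) X.length Y.length = Y := by
  simp [substr]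

variable [LinearOrder α] {X Y : List α} {x y : ℕ → α} {k : ℕ}

theorem orderIsomorphic_substr_iff (hx : ∀ i < X.length, X[i]? = some (x i))
    (hy : ∀ i < Y.length, Y[i]? = some (y i)) {a b l : ℕ} (ha : a + l ≤ X.length)
    (hb : b + l ≤ Y.length) :
    OrderIsomorphic (substr X a l) (substr Y b l) ↔ Match x y a b l := by
  have gx : ∀ p < l, ∀ h, (substr X a l)[p]'h = x (a + p) := by
    intro p hp h
    have := hx (a + p) (by omega)
    rw [List.getElem?_eq_some_iff] at this
    simpa [substr] using this.2
  have gy : ∀ p < l, ∀ h, (substr Y b l)[p]'h = y (b + p) := by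
    intro p hp h
    have := hy (b + p) (by omega)
    rw [List.getElem?_eq_some_iff] at this
    simpa [substr] using this.2
  constructor
  · rintro ⟨h, h'⟩ p hp q hq
    have := h' p q (by rwa [length_substr ha]) (by rwa [length_substr ha])
    rwa [gx p hp, gx q hq, gy p hp, gy q hq] at this
  · intro h
    refine ⟨by rw [length_substr ha, length_substr hb], fun p q hp hq => ?_⟩
    rw [length_substr ha] at hp hq
    rw [gx p hp, gx q hq, gy p hp, gy q hq]
    exact h p hp q hq

theorem IsCommonSubseq.chain (hx : ∀ i < X.length, X[i]? = some (x i))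
    (hy : ∀ i < Y.length, Y[i]? = some (y i)) {Z : List α} (h : IsCommonSubseq k X Y Z) :
    Chain x y k X.length Y.length Z.length := by
  obtain ⟨t, i, j, l, p, h₁, h₂, h₃, h₄, h₅⟩ := h
  have key : ∀ s < t, Chain x y k (i s + l s) (j s + l s) (p (s + 1)) := by
    intro s
    induction s with
    | zero =>
      intro hs
      obtain ⟨hk, hi, hj, hxy, -⟩ := h₁ 0 hs
      rw [h₄ 0 hs, h₃]
      exact .snoc (.nil _ _) hk le_rfl le_rfl ((orderIsomorphic_substr_iff hx hy hi hj).1 hxy)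
    | succ s ih =>
      intro hs
      obtain ⟨hk, hi, hj, hxy, -⟩ := h₁ (s + 1) hs
      obtain ⟨hi', hj'⟩ := h₂ s hs
      rw [h₄ (s + 1) hs]
      exact .snoc ((ih (by omega)).mono hi' hj') hk le_rfl le_rfl
        ((orderIsomorphic_substr_iff hx hy hi hj).1 hxy)
  rw [h₅]
  cases t with
  | zero =>
    rw [h₃]
    exact .nil _ _
  | succ t =>
    obtain ⟨-, hi, hj, -⟩ := h₁ t (by omega)
    exact (key t (by omega)).mono hi hj

/-- `Z` is the concatenation of the blocks chosen in `X`, so its chunks match without further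
argument. The extra conjunct `p s + l s ≤ Z.length` ensures that appending a block leaves the
earlier chunks of `Z` unchanged. -/
theorem Chain.exists_commonSubseq (hx : ∀ i < X.length, X[i]? = some (x i))
    (hy : ∀ i < Y.length, Y[i]? = some (y i)) {a b v : ℕ} (h : Chain x y k a b v)
    (ha : a ≤ X.length) (hb : b ≤ Y.length) :
    ∃ (Z : List α) (t : ℕ) (i j l p : ℕ → ℕ),
      (∀ s < t, k ≤ l s ∧ i s + l s ≤ a ∧ j s + l s ≤ b ∧
        OrderIsomorphic (substr X (i s) (l s)) (substr Y (j s) (l s)) ∧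
        OrderIsomorphic (substr Y (j s) (l s)) (substr Z (p s) (l s)) ∧
        p s + l s ≤ Z.length) ∧
      (∀ s, s + 1 < t → i s + l s ≤ i (s + 1) ∧ j s + l s ≤ j (s + 1)) ∧
      p 0 = 0 ∧ (∀ s < t, p (s + 1) = p s + l s) ∧ Z.length = p t ∧ Z.length = v := by
  induction h with
  | nil =>
    exact ⟨[], 0, fun _ => 0, fun _ => 0, fun _ => 0, fun _ => 0, by simp, by simp, rfl, by simp,
      rfl, rfl⟩
  | @snoc a b v l a' b' h hk hi hj hm ih =>
    obtain ⟨Z, t, i, j, l', p, h₁, h₂, h₃, h₄, h₅, h₆⟩ := ih (by omega) (by omega)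
    have hl := length_substr (X := X) (i := a) (l := l) (by omega)
    have hxy := (orderIsomorphic_substr_iff hx hy (a := a) (b := b) (l := l) (by omega)
      (by omega)).2 hm
    refine ⟨Z ++ substr X a l, t + 1, fun s => if s < t then i s else a,
      fun s => if s < t then j s else b, fun s => if s < t then l' s else l,
      -- The offsets have one more value than the chunks, hence `≤` here: `p t` is already the start
      -- of the new chunk, and `v + l` is the new total length.
      fun s => if s ≤ t then p s else v + l, ?_, ?_, ?_, ?_, ?_, ?_⟩
    · intro s hs
      rcases Nat.lt_or_ge s t with hst | hst
      · obtain ⟨g₁, g₂, g₃, g₄, g₅, g₆⟩ := h₁ s hst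
        simp only [hst, hst.le, if_true, List.length_append, substr_append_left g₆]
        exact ⟨g₁, by omega, by omega, g₄, g₅, by omega⟩
      · obtain rfl : s = t := by omega
        have hz := substr_append_length Z (substr X a l)
        rw [hl] at hz
        simp only [lt_irrefl, le_refl, if_true, if_false, List.length_append, hl, ← h₅, hz]
        exact ⟨hk, hi, hj, hxy, hxy.symm, trivial⟩
    · intro s hs
      have hst : s < t := by omega
      obtain ⟨g₁, g₂, g₃, -⟩ := h₁ s hst
      simp only [hst, if_true]
      by_cases h' : s + 1 < t
      · simpa [h'] using h₂ s h'
      · simpa [h'] using ⟨g₂, g₃⟩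
    · simpa using h₃
    · intro s hs
      rcases Nat.lt_or_ge s t with hst | hst
      · simp [hst, hst.le, Nat.succ_le_of_lt hst, h₄ s hst]
      · obtain rfl : s = t := by omega
        simp [← h₅, h₆]
    · simp [h₆, hl]
    · simp [h₆, hl]

theorem isOpLCSLength_optLen (hx : ∀ i < X.length, X[i]? = some (x i))
    (hy : ∀ i < Y.length, Y[i]? = some (y i)) :
    IsOpLCSLength k X Y (optLen x y k X.length Y.length) := by
  constructor
  · obtain ⟨Z, t, i, j, l, p, h₁, h₂, h₃, h₄, h₅, h₆⟩ :=
      (chain_optLen (x := x) (y := y) (k := k) X.length Y.length).exists_commonSubseq hx hy le_rfl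
        le_rfl
    exact ⟨Z, ⟨t, i, j, l, p, fun s hs => ⟨(h₁ s hs).1, (h₁ s hs).2.1, (h₁ s hs).2.2.1,
      (h₁ s hs).2.2.2.1, (h₁ s hs).2.2.2.2.1⟩, h₂, h₃, h₄, h₅⟩, h₆⟩
  · rintro z ⟨Z, hZ, rfl⟩
    exact (hZ.chain hx hy).le_optLen

/-- A chunk has length at least `k ≥ 1` and cannot fit into an empty string, so only `t = 0` is
possible. -/
theorem isOpLCSLength_zero (hk : 1 ≤ k) (h : X.length = 0 ∨ Y.length = 0) :
    IsOpLCSLength k X Y 0 := by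
  constructor
  · exact ⟨[], ⟨0, fun _ => 0, fun _ => 0, fun _ => 0, fun _ => 0, by simp, by simp, rfl, by simp,
      rfl⟩, rfl⟩
  · rintro z ⟨Z, ⟨t, i, j, l, p, h₁, -, h₃, -, h₅⟩, rfl⟩
    cases t with
    | zero => omega
    | succ t =>
      have := h₁ 0 (by omega)
      omega

/-- Exchanging the strings does not change the optimum, so the shorter one may be put first. -/
theorem optLen_comm (i j : ℕ) : optLen x y k i j = optLen y x k j i :=
  le_antisymm (chain_optLen i j).symm.le_optLen (chain_optLen j i).symm.le_optLen

end Strings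

/-! ### The whole program -/

/-- Set the remaining registers that stay fixed, and solve the problem. -/
def prepareSolve : Program :=
  .assign 8 (.add 4 7) ;; .assign 9 (.add 8 7) ;; .assign 11 (.const 8) ;;
  .assign 9 (.mul 9 11) ;; solve

/-- The program: the answer is `0` if a string is empty; otherwise the shorter string takes the
role of the first one. -/
def program : Program :=
  .assign 7 (.const 1) ;;
  .ite (.lt 0 7) (.assign 0 (.const 0))
    (.ite (.lt 1 7) (.assign 0 (.const 0))
      (.ite (.lt 1 0)
        (.assign 3 (.reg 1) ;; .assign 4 (.reg 0) ;; .assign 5 (.reg 0) ;; .assign 6 (.const 0))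
        (.assign 3 (.reg 0) ;; .assign 4 (.reg 1) ;; .assign 5 (.const 0) ;; .assign 6 (.reg 0)) ;;
      prepareSolve))

/-- The combinatorial part works with total functions; the values beyond the end are irrelevant, but
a default character is needed, hence the nonempty list. -/
theorem exists_getElem?_eq {α : Type u} {X : List α} (h : X.length ≠ 0) :
    ∃ x : ℕ → α, ∀ i < X.length, X[i]? = some (x i) :=
  ⟨fun i => X[i]?.getD (X[0]'(by omega)), fun i hi => by simp [hi]⟩

theorem State.start_reg (m n k r : ℕ) : (State.start m n k).reg r =
    if r = 0 then m else if r = 1 then n else if r = 2 then k else 0 := rfl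

section Program

variable {α : Type u} [LinearOrder α]

theorem wp_prepareSolve {inp : List α} {S W k m n ox oy : ℕ} {x y : ℕ → α}
    (hs : Setting inp S W k m n ox oy x y) (hm : 1 ≤ m) {σ : State} (h2 : σ.reg 2 = k)
    (h3 : σ.reg 3 = m) (h4 : σ.reg 4 = n) (h5 : σ.reg 5 = ox) (h6 : σ.reg 6 = oy)
    (h7 : σ.reg 7 = 1) (h10 : σ.reg 10 = 0) (h0 : ∀ a, σ.mem a = 0) :
    Wp inp S W prepareSolve σ fun t τ =>
      t ≤ 250 * (m * n) + 30 ∧ τ.reg 0 = optLen x y k m n := by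
  have hword := hs.word
  have hmn := hs.le
  have hD : 8 * (n + 2) ≤ 16 * ((m + 1) * (n + 1)) := by nlinarith
  have hD' : (n + 1 + 1) * 8 = 8 * (n + 2) := by ring
  simp only [prepareSolve, Wp.seq_iff, Wp.assign_iff, Expr.value, State.setReg_reg, h4, h7,
    Nat.reduceEqDiff, if_true, if_false]
  refine ⟨by omega, by omega, by omega, by omega, ?_⟩
  refine (wp_solve hs ?_ (by exact h0)).mono ?_
  · constructor <;> simp [h2, h3, h4, h5, h6, h7, h10, hD']
  · rintro t τ ⟨ht, hτ⟩
    -- Here it matters that the first string is the shorter one: the quadratic table of neighbours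
    -- fits into `O(mn)` time.
    have : m * m ≤ m * n := Nat.mul_le_mul_left m hmn
    have : m ≤ m * n := Nat.le_mul_of_pos_right m (by omega)
    have : m * (17 * m + 20) = 17 * (m * m) + 20 * m := by ring
    exact ⟨by omega, hτ⟩

/-- With `N = m + n + k + 2 ≥ 2`, the left side is below `2 ^ 8 * N ^ 2`, hence at most `N ^ 10`. -/
theorem words_suffice (m n k : ℕ) :
    16 * ((m + 1) * (n + 1)) + m + 4 * m + 4 * n + 2 * k + 100 ≤ (m + n + k + 2) ^ 250 := by
  obtain ⟨N, hN⟩ : ∃ N, N = m + n + k + 2 := ⟨_, rfl⟩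
  have h₁ : 2 ^ 8 * N ^ 2 ≤ N ^ 8 * N ^ 2 :=
    Nat.mul_le_mul_right _ (Nat.pow_le_pow_left (by omega) 8)
  rw [← pow_add] at h₁
  have h₂ : N ^ (8 + 2) ≤ N ^ 250 := Nat.pow_le_pow_right (by omega) (by omega)
  have h₃ : (m + 1) * (n + 1) ≤ N ^ 2 := by
    rw [pow_two]
    exact Nat.mul_le_mul (by omega) (by omega)
  have h₄ : 2 * N ≤ N ^ 2 := by
    rw [pow_two]
    exact Nat.mul_le_mul_right _ (by omega)
  rw [← hN]
  have h₅ := h₁.trans h₂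
  generalize N ^ 250 = W at h₅ ⊢
  generalize N ^ 2 = M at *
  omega

theorem wp_program (X Y : List α) {k : ℕ} (hk : 1 ≤ k) :
    Wp (X ++ Y) (250 * (X.length * Y.length + 1)) ((X.length + Y.length + k + 2) ^ 250) program
      (State.start X.length Y.length k) fun t τ =>
        t ≤ 250 * (X.length * Y.length + 1) ∧ IsOpLCSLength k X Y (τ.reg 0) := by
  have hW := words_suffice X.length Y.length k
  generalize (X.length + Y.length + k + 2) ^ 250 = W at hW ⊢
  simp only [program, Wp.seq_iff, Wp.assign_iff, Wp.ite_iff, Test.lt_legal_iff, Test.lt_holds_iff,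
    Expr.value, State.setReg_reg, State.start_reg, Nat.reduceEqDiff, one_ne_zero,
    OfNat.one_ne_ofNat, OfNat.zero_ne_ofNat, if_true, if_false]
  refine ⟨by omega, trivial, fun hX => ⟨by omega, by omega, ?_⟩, fun hX => ⟨trivial, fun hY =>
    ⟨by omega, by omega, ?_⟩, fun hY => ⟨trivial, fun hlt => ?_, fun hge => ?_⟩⟩⟩
  -- Empty strings are treated apart because a table with `(m + 1) * (n + 1)` records exceeds the
  -- budget when `m * n = 0` and the other length is large.
  · exact isOpLCSLength_zero hk (by omega)
  · exact isOpLCSLength_zero hk (by omega)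
  · obtain ⟨x, hx⟩ := exists_getElem?_eq (X := X) (by omega)
    obtain ⟨y, hy⟩ := exists_getElem?_eq (X := Y) (by omega)
    have hpos : 0 < X.length * Y.length := Nat.mul_pos (by omega) (by omega)
    have hcomm := Nat.mul_comm Y.length X.length
    have hcomm' := Nat.mul_comm (Y.length + 1) (X.length + 1)
    refine ⟨by omega, by omega, by omega, by omega, ?_⟩
    -- The roles are exchanged: `Y` comes first and begins at offset `X.length` of the input.
    have hs : Setting (X ++ Y) (250 * (X.length * Y.length + 1)) W k Y.length X.length X.length 0 y x := by
      refine ⟨?_, ?_, hk, hlt.le, by nlinarith, by omega⟩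
      · intro i hi
        rw [List.getElem?_append_right (by omega), Nat.add_sub_cancel_left, hy i hi]
      · intro i hi
        rw [Nat.zero_add, List.getElem?_append_left hi, hx i hi]
    refine (wp_prepareSolve hs (by omega) ?_ ?_ ?_ ?_ ?_ ?_ ?_ ?_).mono ?_
    iterate 7 simp [State.start_reg]
    · exact fun _ => rfl
    · rintro t τ ⟨ht, hτ⟩
      rw [hτ, optLen_comm]
      exact ⟨by omega, isOpLCSLength_optLen hx hy⟩
  · obtain ⟨x, hx⟩ := exists_getElem?_eq (X := X) (by omega)
    obtain ⟨y, hy⟩ := exists_getElem?_eq (X := Y) (by omega)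
    have hpos : 0 < X.length * Y.length := Nat.mul_pos (by omega) (by omega)
    refine ⟨by omega, by omega, by omega, by omega, ?_⟩
    have hs : Setting (X ++ Y) (250 * (X.length * Y.length + 1)) W k X.length Y.length 0 X.length x y := by
      refine ⟨?_, ?_, hk, not_lt.1 hge, by nlinarith, by omega⟩
      · intro i hi
        rw [Nat.zero_add, List.getElem?_append_left hi, hx i hi]
      · intro i hi
        rw [List.getElem?_append_right (by omega), Nat.add_sub_cancel_left, hy i hi]
    refine (wp_prepareSolve hs (by omega) ?_ ?_ ?_ ?_ ?_ ?_ ?_ ?_).mono ?_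
    iterate 7 simp [State.start_reg]
    · exact fun _ => rfl
    · rintro t τ ⟨ht, hτ⟩
      rw [hτ]
      exact ⟨by omega, isOpLCSLength_optLen hx hy⟩

end Program

end OpLCS

theorem theorem2 :
    ∃ (P : OpLCS.Program) (c : ℕ),
      ∀ (α : Type u) [LinearOrder α] (X Y : List α) (k : ℕ), 1 ≤ k →
        ∃ (t : ℕ) (τ : OpLCS.State),
          OpLCS.Exec (X ++ Y)
            (c * (X.length * Y.length + 1))
            ((X.length + Y.length + k + 2) ^ c)
            P (OpLCS.State.start X.length Y.length k) t τ ∧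
          t ≤ c * (X.length * Y.length + 1) ∧
          OpLCS.IsOpLCSLength k X Y (τ.reg 0) :=
  ⟨OpLCS.program, 250, fun _ _ X Y _ hk => OpLCS.wp_program X Y hk⟩
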